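/- For each $n\ge 1$ let $v^{(n)}_1,\dots,v^{(n)}_n$ be distinct labelled points on the real line, forming the set $V=V_n$, and let $G$ be a random graph on $\{1,\dots,n\}$ distributed as the binomial random graph $\mathcal G(n,p)$, with $p=p(n)\in[0,1]$; the distance $|v_i-v_j|$ is known exactly when $ij$ is an edge of $G$. A set $U$ of the points is called reconstructible if the known distances determine all pairwise distances within $U$ (equivalently, determine the points of $U$ up to isometry): whenever $w_1,\dots,w_n$ are distinct reals with $|w_i-w_j|=|v_i-v_j|$ for every edge $ij$ of $G$, then $|w_i-w_j|=|v_i-v_j|$ for all $v_i,v_j\in U$. "Whp" means with probability tending to $1$ as $n\to\infty$; inequalities on $p$ are required for all sufficiently large $n$, and $\log$ is the natural logarithm. Then the following hold. (a) There is an absolute constant $c>0$ such that, for every choice of the point sets $V_n$, if $p\ge 42/n$, then whp there is a reconstructible set of size at least $cn$. (b) If $pn\to\infty$, then there is a sequence $\varepsilon_n\to 0$, depending only on the function $p$, such that for every choice of the point sets $V_n$, whp there is a reconstructible set of size at least $(1-\varepsilon_n)n$. (c) For every choice of the point sets $V_n$, if $p\le(\log n+\log\log n-\omega_n)/n$ for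 some sequence $\omega_n\to\infty$, then whp $V_n$ is not reconstructible. (d) For every choice of the point sets $V_n$, if $p\ge(\log n+\log\log n+\omega_n)/n$ for some sequence $\omega_n\to\infty$, then whp $V_n$ is reconstructible. -/

import Mathlib

open Filter Topology unitInterval

/-- The points are `v i`, `i : Fin n`, and `G` is the graph of known distances. The set `U` of
labels is reconstructible if the known distances determine all distances inside `U`: every
placement `w` of the `n` labelled points at distinct positions of the line that agrees with `v` on
the known distances agrees with `v` on all distances between points of `U`. -/
def Reconstructible {n : ℕ} (v : Fin n → ℝ) (G : SimpleGraph (Fin n))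
    (U : Finset (Fin n)) : Prop :=
  ∀ w : Fin n → ℝ, Function.Injective w →
    (∀ i j, G.Adj i j → |w i - w j| = |v i - v j|) →
    ∀ i ∈ U, ∀ j ∈ U, |w i - w j| = |v i - v j|

/-- With high probability: the binomial random graph on `n` labelled vertices with edge
probability `p n` satisfies `E n` with probability tending to `1` as `n → ∞`. -/
def Whp (p : ℕ → I) (E : (n : ℕ) → SimpleGraph (Fin n) → Prop) : Prop :=
  Tendsto (fun n : ℕ => SimpleGraph.binomialRandom (Fin n) (p n) {G | E n G}) atTop (𝓝 1)

/-! If `w` respects the known distances, then along every edge `w - v` or `w + v` is constant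
(`abs_sub_eq_abs_sub_iff`). Since `v` is injective, a vertex outside a fibre of either function has
at most one neighbour inside it, so all these fibres are `NearlyClosed`. Nearly closed sets are
stable under intersection, and for `pn ≥ 42` a union bound excludes those of size between `n/10` and
`n - 2/p`. Hence there is a least nearly closed set `U` of size at least `n/10`, and it misses fewer
than `2/p` points. A fibre of size at least `n/10` contains `U`, which fixes all distances in `U`.
If all fibres are smaller, two large sets `S`, `T` share no value of either function, so no edge
joins them, which whp does not happen. This is `exists_reconstructible`; it gives (a) and (b).

For (d), above the threshold whp no proper nearly closed set misses fewer than `2/p` points, so `U`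
is everything.

For (c), an isolated vertex can be moved freely, and a leaf can be reflected in its neighbour if the
image is unoccupied. At least `n²/16` ordered pairs have an unoccupied image
(`le_sum_card_freeReflections`), so below the threshold the expected number of movable vertices
tends to infinity, and the second moment method yields one whp. -/

/-! ### Probabilities of prescribed edge patterns -/

open MeasureTheory ProbabilityTheory in
/-- In the binomial random graph, distinct potential edges are present independently of each
other, each with probability `p`. -/
theorem binomialRandom_real_pattern {V ι : Type*} [Finite V] [Fintype ι] (p : I)
    (f : ι → Sym2 V) (hf : Function.Injective f) (hd : ∀ i, ¬ (f i).IsDiag)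
    (b : ι → Prop) [DecidablePred b] :
    (SimpleGraph.binomialRandom V p).real {G | ∀ i, f i ∈ G.edgeSet ↔ b i} =
      ∏ i, if b i then (p : ℝ) else 1 - p := by
  classical
  have himg : SimpleGraph.edgeSet '' {G : SimpleGraph V | ∀ i, f i ∈ G.edgeSet ↔ b i} =
      {s ∈ {s : Set (Sym2 V) | ∀ i, f i ∈ s ↔ b i} | s ⊆ Sym2.diagSetᶜ} := by
    ext s
    constructor
    · rintro ⟨G, hG, rfl⟩
      exact ⟨hG, G.edgeSet_subset_compl_diagSet⟩
    · rintro ⟨hs, hs'⟩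
      have h : (SimpleGraph.fromEdgeSet s).edgeSet = s := by
        rw [SimpleGraph.edgeSet_fromEdgeSet]
        ext e
        simp only [Set.mem_sdiff]
        exact ⟨fun h => h.1, fun h => ⟨h, hs' h⟩⟩
      refine ⟨SimpleGraph.fromEdgeSet s, ?_, h⟩
      simp only [Set.mem_ofPred_eq, h]
      exact hs
  -- The box must be indexed by edges rather than by `ι`; quantifying over the preimages of `e`
  -- avoids inverting `f`.
  have hpre : (fun q : Sym2 V → Prop => {e | q e}) ⁻¹' {s : Set (Sym2 V) | ∀ i, f i ∈ s ↔ b i} =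
      Set.pi (Finset.univ.map ⟨f, hf⟩ : Finset (Sym2 V))
        (fun e => {x : Prop | ∀ i, f i = e → (x ↔ b i)}) := by
    ext q
    simp only [Set.mem_preimage, Set.mem_ofPred_eq, Set.mem_pi, Finset.coe_map, Finset.coe_univ,
      Set.image_univ, Set.mem_range, Function.Embedding.coeFn_mk]
    constructor
    · rintro h _ - i rfl
      exact h i
    · intro h i
      exact h _ ⟨i, rfl⟩ i rfl
  rw [measureReal_def, SimpleGraph.binomialRandom_apply', himg,
    ← setBernoulli_apply_eq_apply_subsets, setBernoulli_apply', hpre,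
    Measure.infinitePi_pi _ (fun _ _ => MeasurableSet.of_discrete), Finset.prod_map,
    ENNReal.toReal_prod]
  refine Finset.prod_congr rfl fun i _ => ?_
  have hset : {x : Prop | ∀ j, f j = f i → (x ↔ b j)} = {x : Prop | x ↔ b i} := by
    ext x
    exact ⟨fun h => h i rfl, fun h j hj => hf hj ▸ h⟩
  have hm : f i ∈ (Sym2.diagSetᶜ : Set (Sym2 V)) := hd i
  simp only [Function.Embedding.coeFn_mk, hset]
  by_cases hb : b i <;> simp [hb, hm]

theorem injective_sym2_mk_of_disjoint {V : Type*} {S T : Finset V} (h : Disjoint S T) :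
    Function.Injective fun a : S × T => s((a.1 : V), (a.2 : V)) := by
  rintro ⟨⟨a, ha⟩, ⟨b, hb⟩⟩ ⟨⟨c, hc⟩, ⟨d, hd⟩⟩ hab
  rcases Sym2.eq_iff.1 hab with ⟨h1, h2⟩ | ⟨h1, h2⟩
  · simp only at h1 h2
    subst h1 h2
    rfl
  · simp only at h1 h2
    subst h1
    exact absurd hd (Finset.disjoint_left.1 h ha)

theorem not_isDiag_sym2_mk_of_disjoint {V : Type*} {S T : Finset V} (h : Disjoint S T)
    (a : S × T) : ¬ s((a.1 : V), (a.2 : V)).IsDiag := by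
  rw [Sym2.mk_isDiag_iff]
  exact fun hab => Finset.disjoint_left.1 h a.1.2 (hab ▸ a.2.2)

theorem one_sub_pow_le_exp (p : I) (k : ℕ) : (1 - (p : ℝ)) ^ k ≤ Real.exp (-(k * p)) := by
  have h : (1 - (p : ℝ)) ≤ Real.exp (-p) := Real.one_sub_le_exp_neg _
  calc (1 - (p : ℝ)) ^ k ≤ Real.exp (-p) ^ k :=
        pow_le_pow_left₀ (by linarith [p.2.2]) h k
    _ = Real.exp (-(k * p)) := by rw [← Real.exp_nat_mul]; congr 1; ring

theorem binomialRandom_real_no_edge_le {V : Type*} [Fintype V] (p : I) {S T : Finset V}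
    (h : Disjoint S T) :
    (SimpleGraph.binomialRandom V p).real {G | ∀ i ∈ S, ∀ j ∈ T, ¬ G.Adj i j} ≤
      Real.exp (-(S.card * T.card * p)) := by
  have hset : {G : SimpleGraph V | ∀ i ∈ S, ∀ j ∈ T, ¬ G.Adj i j} =
      {G | ∀ a : S × T, s((a.1 : V), (a.2 : V)) ∈ G.edgeSet ↔ False} := by
    ext G
    simp only [Set.mem_ofPred_eq, SimpleGraph.mem_edgeSet, iff_false, Prod.forall,
      Subtype.forall]
  rw [hset, binomialRandom_real_pattern p _ (injective_sym2_mk_of_disjoint h)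
    (not_isDiag_sym2_mk_of_disjoint h)]
  simp only [if_false, Finset.prod_const, Finset.card_univ, Fintype.card_prod, Fintype.card_coe]
  refine (one_sub_pow_le_exp p _).trans_eq ?_
  push_cast
  rfl

/-! ### Nearly closed sets and their probability -/

/-- Every vertex outside `R` has at most one neighbour in `R`. -/
def NearlyClosed {V : Type*} (G : SimpleGraph V) (R : Finset V) : Prop :=
  ∀ u ∉ R, ∀ x ∈ R, ∀ y ∈ R, G.Adj u x → G.Adj u y → x = y

/-- A vertex outside `R ∩ S` lies outside `R` or outside `S`, and that set already allows it only
one neighbour. -/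
theorem NearlyClosed.inter {V : Type*} [DecidableEq V] {G : SimpleGraph V} {R S : Finset V}
    (hR : NearlyClosed G R) (hS : NearlyClosed G S) : NearlyClosed G (R ∩ S) := by
  intro u hu x hx y hy hux huy
  rw [Finset.mem_inter] at hx hy
  by_cases huR : u ∈ R
  · have huS : u ∉ S := fun h => hu (Finset.mem_inter.2 ⟨huR, h⟩)
    exact hS u huS x hx.2 y hy.2 hux huy
  · exact hR u huR x hx.1 y hy.1 hux huy

theorem prod_ite_some_of_mem {V : Type*} [DecidableEq V] {D : Finset V} {x : V} (hx : x ∈ D)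
    (a b : ℝ) : ∏ y ∈ D, (if some x = some y then a else b) = a * b ^ (D.card - 1) := by
  rw [← Finset.mul_prod_erase _ _ hx, if_pos rfl, Finset.prod_congr rfl (g := fun _ => b)]
  · simp [Finset.card_erase_of_mem hx]
  · intro y hy
    rw [if_neg]
    simpa [eq_comm] using Finset.ne_of_mem_erase hy

theorem sum_option_prod_ite {α : Type*} [Fintype α] [DecidableEq α] (a b : ℝ) :
    ∑ o : Option α, ∏ x : α, (if o = some x then a else b) =
      b ^ Fintype.card α + Fintype.card α * (a * b ^ (Fintype.card α - 1)) := by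
  rw [Fintype.sum_option,
    Finset.sum_congr rfl fun y _ => prod_ite_some_of_mem (Finset.mem_univ y) a b]
  simp

theorem at_most_one_edge_le (p : I) {r : ℕ} (hr : 1 ≤ r) :
    (1 - (p : ℝ)) ^ r + r * (p * (1 - (p : ℝ)) ^ (r - 1)) ≤
      Real.exp (-((r - 1) * p)) * (1 + (r - 1) * p) := by
  obtain ⟨k, rfl⟩ := Nat.exists_eq_add_of_le' hr
  have h := one_sub_pow_le_exp p k
  have hp := p.2.1
  have : (1 - (p : ℝ)) ^ (k + 1) + ((k + 1 : ℕ) : ℝ) * (p * (1 - (p : ℝ)) ^ (k + 1 - 1)) =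
      (1 - (p : ℝ)) ^ k * (1 + k * p) := by
    simp only [Nat.add_sub_cancel]
    push_cast
    ring
  rw [this]
  push_cast
  rw [add_sub_cancel_right]
  gcongr

-- Union bound over the maps `φ` sending each outside vertex to its neighbour in `R`, or to `none`.
-- Each pattern probability factors over the outside vertices, so the sum over `φ` is a power of the
-- probability that one vertex has at most one neighbour in `R`.
open MeasureTheory in
theorem binomialRandom_real_nearlyClosed_le {V : Type*} [Fintype V] (p : I) {R : Finset V}
    (hR : R.Nonempty) :
    (SimpleGraph.binomialRandom V p).real {G | NearlyClosed G R} ≤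
      (Real.exp (-((R.card - 1) * p)) * (1 + (R.card - 1) * p)) ^ (Fintype.card V - R.card) := by
  classical
  have hdisj : Disjoint Rᶜ R := disjoint_compl_left
  have hsub : {G : SimpleGraph V | NearlyClosed G R} ⊆
      ⋃ φ : ↥Rᶜ → Option R, {G | ∀ a : ↥Rᶜ × R, s((a.1 : V), (a.2 : V)) ∈ G.edgeSet ↔
        φ a.1 = some a.2} := by
    intro G hG
    rw [Set.mem_iUnion]
    refine ⟨fun u => if h : ∃ x : R, G.Adj u x then some h.choose else none, ?_⟩
    rintro ⟨u, x⟩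
    simp only [SimpleGraph.mem_edgeSet]
    split_ifs with h
    · rw [Option.some_inj]
      constructor
      · intro hux
        exact Subtype.ext (hG u (Finset.mem_compl.1 u.2) _ h.choose.2 _ x.2 h.choose_spec hux)
      · intro hx
        exact hx ▸ h.choose_spec
    · simpa using fun hux => h ⟨x, hux⟩
  refine (measureReal_mono hsub (measure_ne_top _ _)).trans ?_
  refine (measureReal_iUnion_fintype_le _).trans ?_
  have hpat : ∀ φ : ↥Rᶜ → Option R, (SimpleGraph.binomialRandom V p).real
      {G | ∀ a : ↥Rᶜ × R, s((a.1 : V), (a.2 : V)) ∈ G.edgeSet ↔ φ a.1 = some a.2} =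
      ∏ u : ↥Rᶜ, ∏ x : R, if φ u = some x then (p : ℝ) else 1 - p := by
    intro φ
    rw [binomialRandom_real_pattern p _ (injective_sym2_mk_of_disjoint hdisj)
      (not_isDiag_sym2_mk_of_disjoint hdisj), ← Finset.univ_product_univ, Finset.prod_product]
  rw [Finset.sum_congr rfl fun φ _ => hpat φ]
  have hprod := Finset.prod_univ_sum (fun _ : ↥Rᶜ => (Finset.univ : Finset (Option R)))
    (fun _ o => ∏ x : R, if o = some x then (p : ℝ) else 1 - p)
  rw [Fintype.piFinset_univ] at hprod
  rw [← hprod, Finset.prod_const, sum_option_prod_ite, Fintype.card_coe, Finset.card_univ,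
    Fintype.card_coe, Finset.card_compl]
  refine pow_le_pow_left₀ ?_ (at_most_one_edge_le p hR.card_pos) _
  have h0 := p.2.1
  have h1 : (0 : ℝ) ≤ 1 - p := by linarith [p.2.2]
  positivity

/-! ### Separated sets from functions with small fibres -/

/-- The counting function of `f` jumps by less than `k`, so at the first value where it reaches `m`
it overshoots by less than `k`. -/
theorem exists_threshold_card {V : Type*} (X : Finset V) (f : V → ℝ) {m k : ℝ} (hm : 0 < m)
    (hmX : m ≤ X.card) (hk : ∀ t, ((X.filter fun i => f i = t).card : ℝ) < k) :
    ∃ t, m ≤ (X.filter fun i => f i ≤ t).card ∧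
      ((X.filter fun i => f i ≤ t).card : ℝ) < m + k := by
  classical
  have hX : X.Nonempty := by
    rw [← Finset.card_pos]
    exact_mod_cast hm.trans_le hmX
  let C := (X.image f).filter fun t => m ≤ ((X.filter fun i => f i ≤ t).card : ℝ)
  have hC : C.Nonempty := by
    obtain ⟨j, hj, hmax⟩ := X.exists_max_image f hX
    refine ⟨f j, Finset.mem_filter.2 ⟨Finset.mem_image_of_mem _ hj, ?_⟩⟩
    rwa [Finset.filter_true_of_mem hmax]
  obtain ⟨t, ht, hmin⟩ := C.exists_min_image id hC
  refine ⟨t, (Finset.mem_filter.1 ht).2, ?_⟩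
  have hlt : ((X.filter fun i => f i < t).card : ℝ) < m := by
    rcases (X.filter fun i => f i < t).eq_empty_or_nonempty with h | h
    · simpa [h] using hm
    · obtain ⟨j, hj, hmax⟩ := Finset.exists_max_image _ f h
      rw [Finset.mem_filter] at hj
      have heq : (X.filter fun i => f i < t) = X.filter fun i => f i ≤ f j := by
        ext i
        simp only [Finset.mem_filter]
        refine and_congr_right fun hi => ⟨fun h => ?_, fun h => h.trans_lt hj.2⟩
        exact hmax i (Finset.mem_filter.2 ⟨hi, h⟩)
      rw [heq]
      by_contra! hcon
      have := hmin (f j) (Finset.mem_filter.2 ⟨Finset.mem_image_of_mem _ hj.1, hcon⟩)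
      exact absurd hj.2 (not_lt.2 this)
  have hunion : (X.filter fun i => f i ≤ t) =
      (X.filter fun i => f i < t) ∪ X.filter fun i => f i = t := by
    ext i
    simp only [Finset.mem_filter, Finset.mem_union, le_iff_lt_or_eq]
    tauto
  have := Finset.card_union_le (X.filter fun i => f i < t) (X.filter fun i => f i = t)
  rw [← hunion] at this
  have : ((X.filter fun i => f i ≤ t).card : ℝ) ≤
    (X.filter fun i => f i < t).card + (X.filter fun i => f i = t).card := by exact_mod_cast this
  linarith [hk t]

/-- If two functions have only small fibres, then there are two large disjoint sets such that no
element of the one shares a value of either function with an element of the other. -/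
theorem exists_separated_of_small_fibers {V : Type*} [Fintype V] [Nonempty V] (a b : V → ℝ)
    (ha : ∀ t, ((Finset.univ.filter fun i => a i = t).card : ℝ) < Fintype.card V / 10)
    (hb : ∀ t, ((Finset.univ.filter fun i => b i = t).card : ℝ) < Fintype.card V / 10) :
    ∃ S T : Finset V, Disjoint S T ∧
      3 / 100 * (Fintype.card V : ℝ) ^ 2 ≤ S.card * T.card ∧
      ∀ i ∈ S, ∀ j ∈ T, a i ≠ a j ∧ b i ≠ b j := by
  classical
  have hn : (0 : ℝ) < Fintype.card V := by exact_mod_cast Fintype.card_pos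
  set n : ℝ := (Fintype.card V : ℝ)
  -- Cutting by `a` gives `|X|` between `9n/20` and `11n/20`; cutting `X` in half by `b` is then
  -- exact up to `n/10`. At least half of `Xᶜ` lies on one side of `s` and is paired with the part
  -- of `X` on the other. The worst case is `(9/40 - 1/10) * (11/40) > 3/100`.
  obtain ⟨t, ht1, ht2⟩ := exists_threshold_card Finset.univ a (m := 9 / 20 * n) (k := n / 10)
    (by positivity) (by rw [Finset.card_univ]; linarith) ha
  set X := Finset.univ.filter fun i => a i ≤ t with hX
  have hXc : (X.card : ℝ) + (Xᶜ).card = n := by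
    rw [← Nat.cast_add, Finset.card_add_card_compl X]
  obtain ⟨s, hs1, hs2⟩ := exists_threshold_card X b (m := X.card / 2) (k := n / 10)
    (by linarith) (by linarith) (fun r => (hb r).trans_le' (by
      exact_mod_cast Finset.card_le_card (Finset.filter_subset_filter _ (Finset.subset_univ _))))
  have e1 : ((X.filter fun i => b i ≤ s).card : ℝ) + (X.filter fun i => ¬ b i ≤ s).card =
      X.card := by exact_mod_cast Finset.card_filter_add_card_filter_not (s := X) fun i => b i ≤ s
  have e2 : ((Xᶜ.filter fun i => b i ≤ s).card : ℝ) + (Xᶜ.filter fun i => ¬ b i ≤ s).card =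
      Xᶜ.card := by exact_mod_cast Finset.card_filter_add_card_filter_not (s := Xᶜ) fun i => b i ≤ s
  have hdisj : ∀ (P Q : V → Prop) [DecidablePred P] [DecidablePred Q],
      Disjoint (X.filter P) (Xᶜ.filter Q) := fun P Q _ _ =>
    (disjoint_compl_right : Disjoint X Xᶜ).mono (Finset.filter_subset _ _)
      (Finset.filter_subset _ _)
  have hsep : ∀ i ∈ X, ∀ j ∈ Xᶜ, a i ≠ a j := by
    intro i hi j hj hij
    simp only [hX, Finset.mem_compl, Finset.mem_filter, Finset.mem_univ, true_and] at hi hj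
    exact hj (hij ▸ hi)
  rcases le_total ((Xᶜ).card / 2 : ℝ) ((Xᶜ.filter fun i => ¬ b i ≤ s).card : ℝ) with h | h
  · refine ⟨_, _, hdisj (fun i => b i ≤ s) (fun i => ¬ b i ≤ s), ?_, ?_⟩
    · have : (X.card / 2 : ℝ) * ((Xᶜ).card / 2) ≤ (X.filter fun i => b i ≤ s).card *
          (Xᶜ.filter fun i => ¬ b i ≤ s).card := by gcongr
      nlinarith
    · intro i hi j hj
      rw [Finset.mem_filter] at hi hj
      exact ⟨hsep i hi.1 j hj.1, fun hij => hj.2 (hij ▸ hi.2)⟩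
  · refine ⟨_, _, hdisj (fun i => ¬ b i ≤ s) (fun i => b i ≤ s), ?_, ?_⟩
    · have : (X.card / 2 - n / 10 : ℝ) * ((Xᶜ).card / 2) ≤ (X.filter fun i => ¬ b i ≤ s).card *
          (Xᶜ.filter fun i => b i ≤ s).card := by
        have h0 : (0 : ℝ) ≤ X.card / 2 - n / 10 := by linarith
        gcongr <;> linarith
      nlinarith
    · intro i hi j hj
      rw [Finset.mem_filter] at hi hj
      exact ⟨hsep i hi.1 j hj.1, fun hij => hi.2 (hij ▸ hj.2)⟩

/-! ### Deterministic criterion for reconstruction -/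

theorem abs_sub_eq_abs_sub_iff (a b c d : ℝ) :
    |a - b| = |c - d| ↔ a - c = b - d ∨ a + c = b + d := by
  rw [abs_eq_abs]
  constructor <;> rintro (h | h)
  · left; linarith
  · right; linarith
  · left; linarith
  · right; linarith

/-- A deterministic sufficient condition for the existence of a large reconstructible set. -/
theorem exists_reconstructible {n : ℕ} (hn : 0 < n) {v : Fin n → ℝ} (hv : Function.Injective v)
    {G : SimpleGraph (Fin n)} {M : ℝ} (hM : 11 / 20 * (n : ℝ) ≤ M)
    (hedge : ∀ S T : Finset (Fin n), Disjoint S T → 3 / 100 * (n : ℝ) ^ 2 ≤ S.card * T.card →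
      ∃ i ∈ S, ∃ j ∈ T, G.Adj i j)
    (hclosed : ∀ R : Finset (Fin n), (n : ℝ) / 10 ≤ R.card → (R.card : ℝ) ≤ M →
      ¬ NearlyClosed G R) :
    ∃ U : Finset (Fin n), Reconstructible v G U ∧ NearlyClosed G U ∧ M < U.card := by
  classical
  have : Nonempty (Fin n) := ⟨⟨0, hn⟩⟩
  have hn0 : (0 : ℝ) < n := by exact_mod_cast hn
  let F : Finset (Finset (Fin n)) :=
    Finset.univ.filter fun R => (n : ℝ) / 10 ≤ R.card ∧ NearlyClosed G R
  have hbig : ∀ R ∈ F, M < R.card := by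
    intro R hR
    by_contra! h
    exact hclosed R (Finset.mem_filter.1 hR).2.1 h (Finset.mem_filter.1 hR).2.2
  have hF : F.Nonempty := by
    refine ⟨Finset.univ, Finset.mem_filter.2 ⟨Finset.mem_univ _, ?_, ?_⟩⟩
    · rw [Finset.card_univ, Fintype.card_fin]; linarith
    · exact fun u hu => absurd (Finset.mem_univ u) hu
  obtain ⟨U, hU, hmin⟩ := F.exists_min_image Finset.card hF
  have hsub : ∀ R ∈ F, U ⊆ R := by
    intro R hR
    -- Two sets larger than `M ≥ 11n/20` meet in at least `2M - n ≥ n/10` points, so the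
    -- intersection stays in `F` and minimality of `U` applies.
    have hcard : (U.card : ℝ) + R.card ≤ (U ∩ R).card + n := by
      have h1 := Finset.card_union_add_card_inter U R
      have h2 := Finset.card_le_univ (U ∪ R)
      rw [Fintype.card_fin] at h2
      have : U.card + R.card ≤ (U ∩ R).card + n := by omega
      exact_mod_cast this
    have hUR : U ∩ R ∈ F := by
      refine Finset.mem_filter.2 ⟨Finset.mem_univ _, ?_, ?_⟩
      · linarith [hbig U hU, hbig R hR]
      · exact (Finset.mem_filter.1 hU).2.2.inter (Finset.mem_filter.1 hR).2.2
    have : U ∩ R = U := Finset.eq_of_subset_of_card_le Finset.inter_subset_left (hmin _ hUR)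
    exact this ▸ Finset.inter_subset_right
  refine ⟨U, ?_, (Finset.mem_filter.1 hU).2.2, hbig U hU⟩
  intro w _ hw i hi j hj
  rw [abs_sub_eq_abs_sub_iff]
  simp only [abs_sub_eq_abs_sub_iff] at hw
  by_contra! hcon
  obtain ⟨S, T, hST, hcard, hsep⟩ := exists_separated_of_small_fibers
    (fun i => w i - v i) (fun i => w i + v i)
    (fun t => by
      rw [Fintype.card_fin]
      by_contra! h
      have hR := hsub (Finset.univ.filter fun i => w i - v i = t)
        (Finset.mem_filter.2 ⟨Finset.mem_univ _, h, ?_⟩)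
      · have h1 := (Finset.mem_filter.1 (hR hi)).2
        have h2 := (Finset.mem_filter.1 (hR hj)).2
        exact hcon.1 (h1.trans h2.symm)
      -- Both edges leave the fibre of `w - v`, so both preserve `w + v`; then `x` and `y` agree in
      -- both functions, hence in `v`.
      · intro u hu x hx y hy hux huy
        simp only [Finset.mem_filter, Finset.mem_univ, true_and] at hu hx hy
        rcases hw u x hux with h1 | h1
        · exact absurd (h1.trans hx) hu
        rcases hw u y huy with h2 | h2
        · exact absurd (h2.trans hy) hu
        exact hv (by linarith))
    (fun t => by
      rw [Fintype.card_fin]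
      by_contra! h
      have hR := hsub (Finset.univ.filter fun i => w i + v i = t)
        (Finset.mem_filter.2 ⟨Finset.mem_univ _, h, ?_⟩)
      · have h1 := (Finset.mem_filter.1 (hR hi)).2
        have h2 := (Finset.mem_filter.1 (hR hj)).2
        exact hcon.2 (h1.trans h2.symm)
      · intro u hu x hx y hy hux huy
        simp only [Finset.mem_filter, Finset.mem_univ, true_and] at hu hx hy
        rcases hw u x hux with h1 | h1
        · rcases hw u y huy with h2 | h2
          · exact hv (by linarith)
          · exact absurd (h2.trans hy) hu
        · exact absurd (h1.trans hx) hu)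
  rw [Fintype.card_fin] at hcard
  obtain ⟨x, hx, y, hy, hxy⟩ := hedge S T hST hcard
  rcases hw x y hxy with h | h
  · exact (hsep x hx y hy).1 h
  · exact (hsep x hx y hy).2 h

/-! ### Union bounds in the random graph -/

open MeasureTheory in
theorem measureReal_exists_mem_le {Ω ι : Type*} [MeasurableSpace Ω] (μ : Measure Ω)
    [IsFiniteMeasure μ] (F : Finset ι) (E : ι → Ω → Prop) :
    μ.real {x | ∃ i ∈ F, E i x} ≤ ∑ i ∈ F, μ.real {x | E i x} := by
  have : {x | ∃ i ∈ F, E i x} = ⋃ i ∈ F, {x | E i x} := by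
    ext x
    simp
  rw [this]
  exact measureReal_biUnion_finset_le _ _

open MeasureTheory in
theorem binomialRandom_real_exists_no_edge_le {n : ℕ} {p : I} (hp : 42 ≤ (p : ℝ) * n) :
    (SimpleGraph.binomialRandom (Fin n) p).real {G | ∃ S T : Finset (Fin n), Disjoint S T ∧
      3 / 100 * (n : ℝ) ^ 2 ≤ S.card * T.card ∧ ∀ i ∈ S, ∀ j ∈ T, ¬ G.Adj i j} ≤
      (3 * Real.exp (-(63 / 50))) ^ n := by
  classical
  -- Three-colourings encode disjoint pairs, so there are at most `3 ^ n` of them. The exponent is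
  -- `63/50 = 42 * 3/100`.
  let S : (Fin n → Fin 3) → Finset (Fin n) := fun χ => Finset.univ.filter fun i => χ i = 0
  let T : (Fin n → Fin 3) → Finset (Fin n) := fun χ => Finset.univ.filter fun i => χ i = 1
  have hST : ∀ χ, Disjoint (S χ) (T χ) := by
    intro χ
    rw [Finset.disjoint_left]
    intro i hi hi'
    simp only [S, T, Finset.mem_filter, Finset.mem_univ, true_and] at hi hi'
    simp [hi] at hi'
  let F : Finset (Fin n → Fin 3) :=
    Finset.univ.filter fun χ => 3 / 100 * (n : ℝ) ^ 2 ≤ (S χ).card * (T χ).card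
  have hsub : {G : SimpleGraph (Fin n) | ∃ S T : Finset (Fin n), Disjoint S T ∧
      3 / 100 * (n : ℝ) ^ 2 ≤ S.card * T.card ∧ ∀ i ∈ S, ∀ j ∈ T, ¬ G.Adj i j} ⊆
      {G | ∃ χ ∈ F, ∀ i ∈ S χ, ∀ j ∈ T χ, ¬ G.Adj i j} := by
    rintro G ⟨A, B, hAB, hcard, hG⟩
    let χ : Fin n → Fin 3 := fun i => if i ∈ A then 0 else if i ∈ B then 1 else 2
    have hA : S χ = A := by
      ext i
      simp only [S, χ, Finset.mem_filter, Finset.mem_univ, true_and]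
      split_ifs <;> simp_all
    have hB : T χ = B := by
      ext i
      simp only [T, χ, Finset.mem_filter, Finset.mem_univ, true_and]
      split_ifs with h1 h2
      · simpa using Finset.disjoint_left.1 hAB h1
      · simp [h2]
      · simp [h2]
    refine ⟨χ, Finset.mem_filter.2 ⟨Finset.mem_univ _, ?_⟩, ?_⟩
    · rwa [hA, hB]
    · rwa [hA, hB]
  refine (measureReal_mono hsub (measure_ne_top _ _)).trans
    ((measureReal_exists_mem_le _ F _).trans ?_)
  have hterm : ∀ χ ∈ F, (SimpleGraph.binomialRandom (Fin n) p).real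
      {G | ∀ i ∈ S χ, ∀ j ∈ T χ, ¬ G.Adj i j} ≤ Real.exp (-(63 / 50)) ^ n := by
    intro χ hχ
    refine (binomialRandom_real_no_edge_le p (hST χ)).trans ?_
    rw [← Real.exp_nat_mul, Real.exp_le_exp]
    have h := (Finset.mem_filter.1 hχ).2
    have h1 := mul_le_mul_of_nonneg_right h p.2.1
    have h2 := mul_le_mul_of_nonneg_left hp (Nat.cast_nonneg (α := ℝ) n)
    nlinarith
  refine (Finset.sum_le_card_nsmul _ _ _ hterm).trans ?_
  rw [nsmul_eq_mul, mul_pow]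
  gcongr
  have := Finset.card_le_univ F
  rw [Fintype.card_fun, Fintype.card_fin, Fintype.card_fin] at this
  exact_mod_cast this

theorem one_add_le_exp_half {x : ℝ} (hx : 3 ≤ x) : 1 + x ≤ Real.exp (x / 2) := by
  have h := Real.quadratic_le_exp_of_nonneg (x := x / 4) (by linarith)
  have h' : Real.exp (x / 2) = Real.exp (x / 4) ^ 2 := by
    rw [← Real.exp_nat_mul]; congr 1; push_cast; ring
  rw [h']
  have h0 : (0 : ℝ) ≤ 1 + x / 4 + (x / 4) ^ 2 / 2 := by positivity
  nlinarith [pow_le_pow_left₀ h0 h 2, mul_nonneg (sq_nonneg x) (sub_nonneg.2 hx)]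

open MeasureTheory in
theorem binomialRandom_real_exists_nearlyClosed_le {n : ℕ} {p : I} (hp : 42 ≤ (p : ℝ) * n)
    (hn : 1000 ≤ n) :
    (SimpleGraph.binomialRandom (Fin n) p).real {G | ∃ R : Finset (Fin n),
      (n : ℝ) / 10 ≤ R.card ∧ (R.card : ℝ) ≤ n - 2 / p ∧ NearlyClosed G R} ≤
      (2 * Real.exp (-(9 / 10))) ^ n := by
  classical
  have hn' : (1000 : ℝ) ≤ n := by exact_mod_cast hn
  have hp0 : 0 < (p : ℝ) := by
    by_contra! h
    nlinarith
  have hp1 := p.2.2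
  let F : Finset (Finset (Fin n)) :=
    Finset.univ.filter fun R => (n : ℝ) / 10 ≤ R.card ∧ (R.card : ℝ) ≤ n - 2 / p
  have hset : {G : SimpleGraph (Fin n) | ∃ R : Finset (Fin n),
      (n : ℝ) / 10 ≤ R.card ∧ (R.card : ℝ) ≤ n - 2 / p ∧ NearlyClosed G R} =
      {G | ∃ R ∈ F, NearlyClosed G R} := by
    ext G
    simp [F, and_assoc]
  rw [hset]
  refine (measureReal_exists_mem_le _ F _).trans ?_
  have hterm : ∀ R ∈ F, (SimpleGraph.binomialRandom (Fin n) p).real {G | NearlyClosed G R} ≤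
      Real.exp (-(9 / 10)) ^ n := by
    intro R hR
    obtain ⟨h1, h2⟩ := (Finset.mem_filter.1 hR).2
    have hr0 : R.Nonempty := by
      rw [← Finset.card_pos]
      have : (0 : ℝ) < R.card := by linarith
      exact_mod_cast this
    refine (binomialRandom_real_nearlyClosed_le p hr0).trans ?_
    have hrn : R.card ≤ n := by simpa using Finset.card_le_univ R
    obtain ⟨s, hs⟩ := Nat.exists_eq_add_of_le hrn
    have hs' : (n : ℝ) = R.card + s := by exact_mod_cast hs
    rw [Fintype.card_fin, show n - R.card = s by omega]
    set r : ℝ := (R.card : ℝ)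
    have hx : 3 ≤ (r - 1) * p := by nlinarith
    have hps : 2 ≤ (p : ℝ) * s := by
      have : 2 / (p : ℝ) ≤ s := by linarith
      rwa [div_le_iff₀' hp0] at this
    have hexp : Real.exp (-((r - 1) * p)) * (1 + (r - 1) * p) ≤
        Real.exp (-((r - 1) * p / 2)) := by
      calc Real.exp (-((r - 1) * p)) * (1 + (r - 1) * p)
          ≤ Real.exp (-((r - 1) * p)) * Real.exp ((r - 1) * p / 2) := by
            gcongr
            exact one_add_le_exp_half hx
        _ = Real.exp (-((r - 1) * p / 2)) := by rw [← Real.exp_add]; congr 1; ring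
    refine (pow_le_pow_left₀ (by positivity) hexp s).trans ?_
    rw [← Real.exp_nat_mul, ← Real.exp_nat_mul, Real.exp_le_exp]
    -- For `r ≥ 19n/20` the bound `ps ≥ 2` suffices, which is the reason for the cutoff `n - 2/p`.
    -- Otherwise `rs ≥ 19n²/400`, and `42 * 19/400` is just below `2`, leaving room for replacing
    -- `r` by `r - 1`.
    suffices h : 9 / 5 * (n : ℝ) ≤ (r - 1) * (p * s) by nlinarith
    rcases le_total (19 / 20 * (n : ℝ)) r with h | h
    · nlinarith
    · have hr : 99 / 100 * r ≤ r - 1 := by linarith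
      have hrs : 19 / 400 * (n : ℝ) ^ 2 ≤ r * s := by
        have : (s : ℝ) = n - r := by linarith
        rw [this]
        nlinarith
      have h3 : 42 * (19 / 400 * (n : ℝ)) ≤ p * (r * s) := by
        nlinarith
      nlinarith
  refine (Finset.sum_le_card_nsmul _ _ _ hterm).trans ?_
  rw [nsmul_eq_mul, mul_pow]
  gcongr
  have := Finset.card_le_univ F
  rw [Fintype.card_finset, Fintype.card_fin] at this
  exact_mod_cast this

-- If `R` misses `s < 2/p` points, then `(|R| - 1)p ≥ pn - 3`, so each missing point costs a factor
-- at most `z`. Summing `z ^ s` over all proper subsets gives `(1 + z) ^ n - 1`.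
open MeasureTheory in
theorem binomialRandom_real_exists_large_nearlyClosed_le {n : ℕ} {p : I}
    (hp : 42 ≤ (p : ℝ) * n) :
    (SimpleGraph.binomialRandom (Fin n) p).real {G | ∃ R : Finset (Fin n),
      R ≠ Finset.univ ∧ (n : ℝ) - 2 / p < R.card ∧ NearlyClosed G R} ≤
      Real.exp (n * (Real.exp (3 - p * n) * (1 + p * n))) - 1 := by
  classical
  have hp0 : 0 < (p : ℝ) := by
    by_contra! h
    have := Nat.cast_nonneg (α := ℝ) n
    nlinarith
  have hp1 := p.2.2
  set z : ℝ := Real.exp (3 - p * n) * (1 + p * n)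
  have hz : 0 ≤ z := by positivity
  let F : Finset (Finset (Fin n)) :=
    (Finset.univ.erase Finset.univ).filter fun R => (n : ℝ) - 2 / p < R.card
  have hset : {G : SimpleGraph (Fin n) | ∃ R : Finset (Fin n),
      R ≠ Finset.univ ∧ (n : ℝ) - 2 / p < R.card ∧ NearlyClosed G R} =
      {G | ∃ R ∈ F, NearlyClosed G R} := by
    ext G
    simp [F, and_assoc]
  rw [hset]
  refine (measureReal_exists_mem_le _ F _).trans ?_
  have hterm : ∀ R ∈ F, (SimpleGraph.binomialRandom (Fin n) p).real {G | NearlyClosed G R} ≤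
      z ^ (n - R.card) := by
    intro R hR
    have h2 := (Finset.mem_filter.1 hR).2
    have hdiv : 2 / (p : ℝ) < n := by rw [div_lt_iff₀' hp0]; linarith
    have hr0 : R.Nonempty := by
      rw [← Finset.card_pos]
      have : (0 : ℝ) < R.card := by linarith
      exact_mod_cast this
    refine (binomialRandom_real_nearlyClosed_le p hr0).trans ?_
    rw [Fintype.card_fin]
    have hr1 : (1 : ℝ) ≤ R.card := by exact_mod_cast hr0.card_pos
    have hrn : (R.card : ℝ) ≤ n := by exact_mod_cast (by simpa using Finset.card_le_univ R)
    have hsp : ((n : ℝ) - R.card) * p < 2 := by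
      have : (n : ℝ) - R.card < 2 / p := by linarith
      rwa [lt_div_iff₀ hp0] at this
    have h0 : 0 ≤ ((R.card : ℝ) - 1) * p := mul_nonneg (by linarith) hp0.le
    refine pow_le_pow_left₀ (by positivity) ?_ _
    simp only [z]
    gcongr ?_ * ?_
    · rw [Real.exp_le_exp]; nlinarith
    · nlinarith
  refine (Finset.sum_le_sum hterm).trans ?_
  have hmono : ∑ R ∈ F, z ^ (n - R.card) ≤
      ∑ R ∈ (Finset.univ : Finset (Finset (Fin n))).erase Finset.univ, z ^ (n - R.card) :=
    Finset.sum_le_sum_of_subset_of_nonneg (Finset.filter_subset _ _) fun _ _ _ => by positivity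
  refine hmono.trans ?_
  have hsum : ∑ R : Finset (Fin n), z ^ (n - R.card) = (1 + z) ^ n := by
    have := Finset.sum_pow_mul_eq_add_pow 1 z (Finset.univ : Finset (Fin n))
    simpa using this
  have herase := Finset.add_sum_erase (Finset.univ : Finset (Finset (Fin n)))
    (fun R => z ^ (n - R.card)) (Finset.mem_univ Finset.univ)
  rw [hsum] at herase
  simp only [Finset.card_univ, Fintype.card_fin, Nat.sub_self, pow_zero] at herase
  have hle : (1 + z) ^ n ≤ Real.exp (n * z) := by
    rw [Real.exp_nat_mul]
    exact pow_le_pow_left₀ (by linarith) (by linarith [Real.add_one_le_exp z]) n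
  linarith

/-! ### Passing to high probability: large reconstructible sets -/

open MeasureTheory in
theorem Whp.of_real_le {p : ℕ → I} {E : (n : ℕ) → SimpleGraph (Fin n) → Prop} {b : ℕ → ℝ}
    (hb : Tendsto b atTop (𝓝 0))
    (h : ∀ᶠ n in atTop,
      (SimpleGraph.binomialRandom (Fin n) (p n)).real {G | ¬ E n G} ≤ b n) : Whp p E := by
  have h1 : Tendsto (fun n => ENNReal.ofReal (1 - b n)) atTop (𝓝 1) := by
    have := ENNReal.tendsto_ofReal (tendsto_const_nhds.sub hb : Tendsto (fun n => 1 - b n) _ _)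
    simpa using this
  refine tendsto_of_tendsto_of_tendsto_of_le_of_le' h1 tendsto_const_nhds ?_
    (Eventually.of_forall fun n => prob_le_one)
  filter_upwards [h] with n hn
  have hun : {G | E n G} ∪ {G | ¬ E n G} = Set.univ := by
    ext G
    simpa using em (E n G)
  have := measureReal_union_le (μ := SimpleGraph.binomialRandom (Fin n) (p n))
    {G | E n G} {G | ¬ E n G}
  rw [hun, probReal_univ] at this
  rw [ENNReal.ofReal_le_iff_le_toReal (measure_ne_top _ _), ← measureReal_def]
  linarith

open MeasureTheory in
theorem Whp.mono {p : ℕ → I} {E F : (n : ℕ) → SimpleGraph (Fin n) → Prop} (hE : Whp p E)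
    (h : ∀ᶠ n in atTop, ∀ G, E n G → F n G) : Whp p F := by
  refine tendsto_of_tendsto_of_tendsto_of_le_of_le' hE tendsto_const_nhds ?_
    (Eventually.of_forall fun n => prob_le_one)
  filter_upwards [h] with n hn
  exact measure_mono fun G hG => hn G hG

/-- The probability that the conditions of `exists_reconstructible` fail is exponentially
small. -/
theorem binomialRandom_real_not_exists_reconstructible_le {n : ℕ} {p : I}
    (hp : 42 ≤ (p : ℝ) * n) (hn : 1000 ≤ n) {v : Fin n → ℝ} (hv : Function.Injective v) :
    (SimpleGraph.binomialRandom (Fin n) p).real {G | ¬ ∃ U : Finset (Fin n),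
      Reconstructible v G U ∧ NearlyClosed G U ∧ (n : ℝ) - 2 / p < U.card} ≤
      (3 * Real.exp (-(63 / 50))) ^ n + (2 * Real.exp (-(9 / 10))) ^ n := by
  have hn' : (1000 : ℝ) ≤ n := by exact_mod_cast hn
  have hp0 : 0 < (p : ℝ) := by
    by_contra! h
    nlinarith
  -- Thus `n - 2/p ≥ 20n/21`, well above the required `11n/20`.
  have hdiv : 2 / (p : ℝ) ≤ n / 21 := by
    rw [div_le_iff₀ hp0]
    linarith
  refine le_trans ?_ (add_le_add (binomialRandom_real_exists_no_edge_le hp)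
    (binomialRandom_real_exists_nearlyClosed_le hp hn))
  refine le_trans (MeasureTheory.measureReal_mono ?_ (MeasureTheory.measure_ne_top _ _))
    (MeasureTheory.measureReal_union_le _ _)
  intro G hG
  by_contra hcon
  simp only [Set.mem_union, Set.mem_ofPred_eq, not_or, not_exists, not_and] at hcon
  refine hG (exists_reconstructible (by omega) hv (by linarith) ?_ ?_)
  · intro S T hST hcard
    have := hcon.1 S T hST hcard
    push Not at this
    exact this
  · exact hcon.2

theorem tendsto_pow_add_pow_exp :
    Tendsto (fun n : ℕ => (3 * Real.exp (-(63 / 50))) ^ n + (2 * Real.exp (-(9 / 10))) ^ n)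
      atTop (𝓝 0) := by
  have h1 : 3 * Real.exp (-(63 / 50)) < 1 := by
    rw [Real.exp_neg, ← div_eq_mul_inv, div_lt_one (Real.exp_pos _)]
    have := Real.quadratic_le_exp_of_nonneg (x := 63 / 50) (by norm_num)
    norm_num at this ⊢
    linarith
  have h2 : 2 * Real.exp (-(9 / 10)) < 1 := by
    rw [Real.exp_neg, ← div_eq_mul_inv, div_lt_one (Real.exp_pos _)]
    have := Real.quadratic_le_exp_of_nonneg (x := 9 / 10) (by norm_num)
    norm_num at this ⊢
    linarith
  simpa using (tendsto_pow_atTop_nhds_zero_of_lt_one (by positivity) h1).add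
    (tendsto_pow_atTop_nhds_zero_of_lt_one (by positivity) h2)

theorem whp_exists_reconstructible {p : ℕ → I} (hp : ∀ᶠ n : ℕ in atTop, 42 ≤ (p n : ℝ) * n)
    {v : (n : ℕ) → Fin n → ℝ} (hv : ∀ n, Function.Injective (v n)) :
    Whp p fun n G => ∃ U : Finset (Fin n), Reconstructible (v n) G U ∧ NearlyClosed G U ∧
      (n : ℝ) - 2 / p n < U.card := by
  refine Whp.of_real_le tendsto_pow_add_pow_exp ?_
  filter_upwards [hp, eventually_ge_atTop 1000] with n hpn hn
  exact binomialRandom_real_not_exists_reconstructible_le hpn hn (hv n)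

theorem exists_linear_reconstructible :
    ∃ c : ℝ, 0 < c ∧
      ∀ (v : (n : ℕ) → Fin n → ℝ) (p : ℕ → I), (∀ n, Function.Injective (v n)) →
        (∀ᶠ n : ℕ in atTop, 42 / (n : ℝ) ≤ (p n : ℝ)) →
        Whp p fun n G => ∃ U : Finset (Fin n), Reconstructible (v n) G U ∧
          c * (n : ℝ) ≤ (U.card : ℝ) := by
  refine ⟨1 / 2, by norm_num, fun v p hv hp => ?_⟩
  have hp' : ∀ᶠ n : ℕ in atTop, 42 ≤ (p n : ℝ) * n := by
    filter_upwards [hp, eventually_gt_atTop 0] with n hpn hn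
    rwa [div_le_iff₀ (by exact_mod_cast hn)] at hpn
  refine (whp_exists_reconstructible hp' hv).mono ?_
  filter_upwards [hp'] with n hpn G
  rintro ⟨U, hU, -, hcard⟩
  refine ⟨U, hU, ?_⟩
  have hn0 := Nat.cast_nonneg (α := ℝ) n
  have hp0 : 0 < (p n : ℝ) := by
    by_contra! h
    nlinarith
  have hdiv : 2 / (p n : ℝ) ≤ n / 2 := by
    rw [div_le_iff₀ hp0]
    linarith
  linarith

theorem exists_almost_spanning_reconstructible (p : ℕ → I)
    (hp : Tendsto (fun n : ℕ => (p n : ℝ) * (n : ℝ)) atTop atTop) :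
    ∃ ε : ℕ → ℝ, Tendsto ε atTop (𝓝 0) ∧
      ∀ v : (n : ℕ) → Fin n → ℝ, (∀ n, Function.Injective (v n)) →
        Whp p fun n G => ∃ U : Finset (Fin n), Reconstructible (v n) G U ∧
          (1 - ε n) * (n : ℝ) ≤ (U.card : ℝ) := by
  refine ⟨fun n => 2 / (p n * n), hp.const_div_atTop 2, fun v hv => ?_⟩
  have hp' := hp.eventually_ge_atTop 42
  refine (whp_exists_reconstructible hp' hv).mono ?_
  filter_upwards [hp', eventually_gt_atTop 0] with n hpn hn G
  rintro ⟨U, hU, -, hcard⟩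
  refine ⟨U, hU, ?_⟩
  have hn0 : (0 : ℝ) < n := by exact_mod_cast hn
  have hp0 : 0 < (p n : ℝ) := by
    by_contra! h
    nlinarith
  have : (1 - 2 / ((p n : ℝ) * n)) * n = n - 2 / p n := by field_simp
  linarith

/-! ### Reconstruction of the whole set above the threshold -/

/-- This is the Poisson probability of at most one event; monotonicity lets `pn` be replaced by its
threshold value in (c) and (d). -/
theorem exp_neg_mul_one_add_antitone {x y : ℝ} (hx : 0 ≤ x) (hxy : x ≤ y) :
    Real.exp (-y) * (1 + y) ≤ Real.exp (-x) * (1 + x) := by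
  have h := Real.add_one_le_exp (y - x)
  have hy : Real.exp (-x) = Real.exp (-y) * Real.exp (y - x) := by
    rw [← Real.exp_add]; congr 1; ring
  rw [hy, mul_assoc]
  gcongr
  nlinarith

theorem eventually_log_log_le :
    ∀ᶠ n : ℕ in atTop, 1 ≤ Real.log n ∧ 0 ≤ Real.log (Real.log n) ∧
      Real.log (Real.log n) ≤ Real.log n := by
  have h : Tendsto (fun n : ℕ => Real.log n) atTop atTop :=
    Real.tendsto_log_atTop.comp tendsto_natCast_atTop_atTop
  filter_upwards [h.eventually_ge_atTop 1] with n hn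
  exact ⟨hn, Real.log_nonneg hn, by
    linarith [Real.log_le_sub_one_of_pos (by linarith : 0 < Real.log n)]⟩

theorem exp_neg_log_add_log_log {n : ℕ} (hn : 1 ≤ Real.log n) (t : ℝ) :
    Real.exp (-(Real.log n + Real.log (Real.log n) + t)) =
      Real.exp (-t) / (n * Real.log n) := by
  have hn0 : (0 : ℝ) < n := by
    rcases Nat.eq_zero_or_pos n with rfl | h
    · norm_num at hn
    · exact_mod_cast h
  rw [show -(Real.log n + Real.log (Real.log n) + t) =
    -t - Real.log n - Real.log (Real.log n) by ring, Real.exp_sub, Real.exp_sub,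
    Real.exp_log hn0, Real.exp_log (by linarith), div_div]

/-- The `log log n` in the threshold cancels the factor `1 + pn ≈ log n`, so `z`, which here
includes the factor `n`, tends to zero. Then no proper nearly closed set misses fewer than `2/p`
points. -/
theorem whp_reconstructible_univ (v : (n : ℕ) → Fin n → ℝ) (p : ℕ → I) (ω : ℕ → ℝ)
    (hv : ∀ n, Function.Injective (v n)) (hω : Tendsto ω atTop atTop)
    (hp : ∀ᶠ n : ℕ in atTop,
      (Real.log n + Real.log (Real.log n) + ω n) / (n : ℝ) ≤ (p n : ℝ)) :
    Whp p fun n G => Reconstructible (v n) G Finset.univ := by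
  have hp' : ∀ᶠ n : ℕ in atTop,
      Real.log n + Real.log (Real.log n) + ω n ≤ (p n : ℝ) * n := by
    filter_upwards [hp, eventually_gt_atTop 0] with n hpn hn
    rwa [div_le_iff₀ (by exact_mod_cast hn)] at hpn
  set z : ℕ → ℝ := fun n => n * (Real.exp (3 - p n * n) * (1 + p n * n))
  have hz : Tendsto z atTop (𝓝 0) := by
    have hlim : Tendsto (fun n => Real.exp 3 * (3 * Real.exp (-ω n) + ω n * Real.exp (-ω n)))
        atTop (𝓝 0) := by
      have h1 : Tendsto (fun n => Real.exp (-ω n)) atTop (𝓝 0) :=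
        Real.tendsto_exp_neg_atTop_nhds_zero.comp hω
      have h2 : Tendsto (fun n => ω n * Real.exp (-ω n)) atTop (𝓝 0) := by
        simpa [Function.comp_def] using (Real.tendsto_pow_mul_exp_neg_atTop_nhds_zero 1).comp hω
      simpa using ((h1.const_mul 3).add h2).const_mul (Real.exp 3)
    refine tendsto_of_tendsto_of_tendsto_of_le_of_le' tendsto_const_nhds hlim ?_ ?_
    · refine Eventually.of_forall fun n => ?_
      have := (p n).2.1
      positivity
    · filter_upwards [hp', eventually_log_log_le, hω.eventually_ge_atTop 0, eventually_gt_atTop 0]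
        with n hpn hl hωn hn
      obtain ⟨hl1, hl2, hl3⟩ := hl
      have hn0 : (0 : ℝ) < n := by exact_mod_cast hn
      have hanti := exp_neg_mul_one_add_antitone (by linarith) hpn
      rw [exp_neg_log_add_log_log hl1] at hanti
      have hbound : Real.exp (-ω n) / (n * Real.log n) *
          (1 + (Real.log n + Real.log (Real.log n) + ω n)) ≤
          (3 * Real.exp (-ω n) + ω n * Real.exp (-ω n)) / n := by
        rw [div_mul_eq_mul_div, div_le_div_iff₀ (by positivity) hn0]
        have hnum : 1 + (Real.log n + Real.log (Real.log n) + ω n) ≤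
            (3 + ω n) * Real.log n := by nlinarith
        calc Real.exp (-ω n) * (1 + (Real.log n + Real.log (Real.log n) + ω n)) * n
            ≤ Real.exp (-ω n) * ((3 + ω n) * Real.log n) * n := by gcongr
          _ = _ := by ring
      have := hanti.trans hbound
      rw [le_div_iff₀ hn0] at this
      have hzn : z n = Real.exp 3 * (Real.exp (-(p n * n)) * (1 + p n * n) * n) := by
        simp only [z]
        rw [sub_eq_add_neg, Real.exp_add]
        ring
      rw [hzn]
      gcongr
  have hz' : Tendsto (fun n => Real.exp (z n) - 1) atTop (𝓝 0) := by
    simpa using ((Real.continuous_exp.tendsto 0).comp hz).sub_const 1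
  refine Whp.of_real_le (by simpa using tendsto_pow_add_pow_exp.add hz') ?_
  filter_upwards [hp', eventually_log_log_le, hω.eventually_ge_atTop 42,
    eventually_ge_atTop 1000] with n hpn hl hωn hn
  have h42 : 42 ≤ (p n : ℝ) * n := by linarith
  refine le_trans ?_ (add_le_add
    (binomialRandom_real_not_exists_reconstructible_le h42 hn (hv n))
    (binomialRandom_real_exists_large_nearlyClosed_le h42))
  refine le_trans (MeasureTheory.measureReal_mono ?_ (MeasureTheory.measure_ne_top _ _))
    (MeasureTheory.measureReal_union_le _ _)
  intro G hG
  by_contra hcon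
  simp only [Set.mem_union, Set.mem_ofPred_eq, not_or, not_not] at hcon
  obtain ⟨⟨U, hU, hUc, hcard⟩, h2⟩ := hcon
  by_cases hUu : U = Finset.univ
  · exact hG (hUu ▸ hU)
  · exact h2 ⟨U, hUu, hcard, hUc⟩

/-! ### Movable points and free reflections -/

/-- If the point `u` can be moved to an unoccupied position without changing its distances to its
neighbours, then the points are not reconstructible. -/
theorem not_reconstructible_univ_of_move {n : ℕ} {v : Fin n → ℝ} (hv : Function.Injective v)
    {G : SimpleGraph (Fin n)} {u y : Fin n} (hyu : y ≠ u) {t : ℝ} (ht : ∀ i, v i ≠ t)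
    (hty : t ≠ 2 * v y - v u) (hadj : ∀ x, G.Adj u x → |t - v x| = |v u - v x|) :
    ¬ Reconstructible v G Finset.univ := by
  intro h
  have hw : Function.Injective (Function.update v u t) := by
    intro i j hij
    by_cases hi : i = u <;> by_cases hj : j = u
    · exact hi.trans hj.symm
    · subst hi
      rw [Function.update_self, Function.update_of_ne hj] at hij
      exact absurd hij.symm (ht j)
    · subst hj
      rw [Function.update_self, Function.update_of_ne hi] at hij
      exact absurd hij (ht i)
    · rw [Function.update_of_ne hi, Function.update_of_ne hj] at hij
      exact hv hij
  have hG : ∀ i j, G.Adj i j →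
      |Function.update v u t i - Function.update v u t j| = |v i - v j| := by
    intro i j hij
    by_cases hi : i = u
    · subst hi
      rw [Function.update_self, Function.update_of_ne hij.ne', hadj j hij]
    · rw [Function.update_of_ne hi]
      by_cases hj : j = u
      · subst hj
        rw [Function.update_self, abs_sub_comm, hadj i hij.symm, abs_sub_comm]
      · rw [Function.update_of_ne hj]
  -- The distance from `u` to `y` survives only if `t` is `v u`, which is occupied, or the
  -- reflection of `v u` in `v y`, which `hty` excludes.
  have := h _ hw hG u (Finset.mem_univ _) y (Finset.mem_univ _)
  rw [Function.update_self, Function.update_of_ne hyu, abs_eq_abs] at this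
  rcases this with h | h
  · exact ht u (by linarith)
  · exact hty (by linarith)

/-- The neighbourhood of `u` is given by `o`: it is empty for `none` and `{x}` for `some x`. -/
def HasStar {V : Type*} (G : SimpleGraph V) (u : V) (o : Option V) : Prop :=
  ∀ y, y ≠ u → (G.Adj u y ↔ o = some y)

/-- The points `x` different from `u` such that the reflection of `u` in `x` is not occupied. -/
noncomputable def freeReflections {n : ℕ} (v : Fin n → ℝ) (u : Fin n) : Finset (Fin n) :=
  Finset.univ.filter fun x => x ≠ u ∧ ∀ i, v i ≠ 2 * v x - v u

/-- An isolated `u` moves to a generic position, a leaf to its mirror image in its neighbour `x`. In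
the second case a third point `y` detects the move, whence `3 ≤ n`. -/
theorem not_reconstructible_univ_of_hasStar {n : ℕ} (hn : 3 ≤ n) {v : Fin n → ℝ}
    (hv : Function.Injective v) {G : SimpleGraph (Fin n)} {u : Fin n} {o : Option (Fin n)}
    (ho : o ∈ Finset.insertNone (freeReflections v u)) (hG : HasStar G u o) :
    ¬ Reconstructible v G Finset.univ := by
  rcases o with _ | x
  · obtain ⟨y, hy⟩ : ∃ y, y ≠ u := by
      have : Nontrivial (Fin n) := Fin.nontrivial_iff_two_le.2 (by omega)
      exact exists_ne u
    obtain ⟨t, ht⟩ := Infinite.exists_notMem_finset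
      (insert (2 * v y - v u) (Finset.univ.image v))
    simp only [Finset.mem_insert, Finset.mem_image, Finset.mem_univ, true_and, not_or,
      not_exists] at ht
    refine not_reconstructible_univ_of_move hv hy ht.2 ht.1 fun x hx => ?_
    simpa using (hG x hx.ne').1 hx
  · have hx : x ≠ u ∧ ∀ i, v i ≠ 2 * v x - v u := by
      simpa [freeReflections] using ho
    obtain ⟨y, hy⟩ : ∃ y, y ∉ ({u, x} : Finset (Fin n)) := by
      by_contra! h
      have h1 := Finset.card_le_card (fun y _ => h y : Finset.univ ⊆ ({u, x} : Finset (Fin n)))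
      have h2 := Finset.card_le_two (a := u) (b := x)
      rw [Finset.card_univ, Fintype.card_fin] at h1
      omega
    simp only [Finset.mem_insert, Finset.mem_singleton, not_or] at hy
    refine not_reconstructible_univ_of_move hv hy.1 hx.2 (fun h => hy.2 (hv ?_)) fun z hz => ?_
    · linarith
    · have : x = z := by simpa using (hG z hz.ne').1 hz
      subst this
      rw [abs_sub_comm (v u)]
      congr 1
      ring

theorem card_lt_filter_injective {n : ℕ} {v : Fin n → ℝ} (hv : Function.Injective v) :
    Function.Injective fun x => (Finset.univ.filter fun y => v y < v x).card := by
  have hlt : ∀ x x', v x < v x' → (Finset.univ.filter fun y => v y < v x).card <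
      (Finset.univ.filter fun y => v y < v x').card := by
    intro x x' h
    refine Finset.card_lt_card (Finset.ssubset_iff_of_subset ?_ |>.2 ⟨x, ?_, ?_⟩)
    · intro y hy
      simp only [Finset.mem_filter, Finset.mem_univ, true_and] at hy ⊢
      exact hy.trans h
    · simpa using h
    · simp
  intro x x' h
  rcases lt_trichotomy (v x) (v x') with h' | h' | h'
  · exact absurd h (hlt _ _ h').ne
  · exact hv h'
  · exact absurd h (hlt _ _ h').ne'

/-- Let `k` points lie left of `x`. Points right of `x` with occupied reflections have distinct
images on the left, so there are at most `k` of them; they, the left points and `x` itself are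
discarded. -/
theorem le_card_filter_mem_freeReflections {n : ℕ} {v : Fin n → ℝ} (hv : Function.Injective v)
    (x : Fin n) :
    n - 1 - 2 * (Finset.univ.filter fun y => v y < v x).card ≤
      (Finset.univ.filter fun u => x ∈ freeReflections v u).card := by
  classical
  set L := Finset.univ.filter fun y => v y < v x
  set B := Finset.univ.filter fun u => v x < v u ∧ ∃ i, v i = 2 * v x - v u
  set A := Finset.univ.filter fun u => x ∈ freeReflections v u
  have hB : B.card ≤ L.card := by
    have hex : ∀ u ∈ B, ∃ i ∈ L, v i = 2 * v x - v u := by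
      intro u hu
      obtain ⟨h1, i, hi⟩ := (Finset.mem_filter.1 hu).2
      exact ⟨i, Finset.mem_filter.2 ⟨Finset.mem_univ _, by linarith⟩, hi⟩
    choose! g hgL hg using hex
    refine Finset.card_le_card_of_injOn g hgL fun a ha b hb hab => hv ?_
    have h1 := hg a ha
    have h2 := hg b hb
    rw [hab] at h1
    linarith
  have hcover : (Finset.univ : Finset (Fin n)) ⊆ insert x (A ∪ (L ∪ B)) := by
    intro u _
    rw [Finset.mem_insert, Finset.mem_union, Finset.mem_union]
    by_cases hux : u = x
    · exact Or.inl hux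
    by_cases hi : ∃ i, v i = 2 * v x - v u
    · refine Or.inr (Or.inr ?_)
      rcases lt_or_gt_of_ne (fun h => hux (hv h) : v u ≠ v x) with h | h
      · exact Or.inl (Finset.mem_filter.2 ⟨Finset.mem_univ _, h⟩)
      · exact Or.inr (Finset.mem_filter.2 ⟨Finset.mem_univ _, h, hi⟩)
    · refine Or.inr (Or.inl (Finset.mem_filter.2 ⟨Finset.mem_univ _, ?_⟩))
      push Not at hi
      exact Finset.mem_filter.2 ⟨Finset.mem_univ _, Ne.symm hux, hi⟩
  have h1 := Finset.card_le_card hcover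
  rw [Finset.card_univ, Fintype.card_fin] at h1
  have h2 := Finset.card_insert_le x (A ∪ (L ∪ B))
  have h3 := Finset.card_union_le A (L ∪ B)
  have h4 := Finset.card_union_le L B
  omega

theorem le_sum_card_freeReflections {n : ℕ} (hn : 16 ≤ n) {v : Fin n → ℝ}
    (hv : Function.Injective v) :
    (n : ℝ) ^ 2 / 16 ≤ ∑ u, ((freeReflections v u).card : ℝ) := by
  classical
  have hswap : ∑ u, (freeReflections v u).card =
      ∑ x, (Finset.univ.filter fun u => x ∈ freeReflections v u).card := by
    have := Finset.sum_card_bipartiteAbove_eq_sum_card_bipartiteBelow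
      (s := (Finset.univ : Finset (Fin n))) (t := (Finset.univ : Finset (Fin n)))
      (fun u x => x ∈ freeReflections v u)
    simpa [Finset.bipartiteAbove, Finset.bipartiteBelow] using this
  let rank : Fin n → Fin n := fun x => ⟨(Finset.univ.filter fun y => v y < v x).card, by
    have : (Finset.univ.filter fun y => v y < v x) ⊂ Finset.univ :=
      Finset.filter_ssubset.2 ⟨x, Finset.mem_univ _, lt_irrefl _⟩
    simpa using Finset.card_lt_card this⟩
  have hrank : Function.Bijective rank := by
    refine Finite.injective_iff_bijective.1 fun x x' h => ?_
    exact card_lt_filter_injective hv (Fin.ext_iff.1 h)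
  have h1 : ∑ k : Fin n, (n - 1 - 2 * (k : ℕ)) ≤ ∑ u, (freeReflections v u).card := by
    rw [hswap, ← hrank.sum_comp fun k : Fin n => n - 1 - 2 * (k : ℕ)]
    exact Finset.sum_le_sum fun x _ => le_card_filter_mem_freeReflections hv x
  -- Only ranks below `n / 4` are used; truncated subtraction keeps the other terms nonnegative.
  have h2 : n / 4 * (n - 1 - 2 * (n / 4)) ≤ ∑ k : Fin n, (n - 1 - 2 * (k : ℕ)) := by
    rw [Fin.sum_univ_eq_sum_range fun k => n - 1 - 2 * k]
    calc n / 4 * (n - 1 - 2 * (n / 4)) = ∑ k ∈ Finset.range (n / 4), (n - 1 - 2 * (n / 4)) := by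
          simp
      _ ≤ ∑ k ∈ Finset.range (n / 4), (n - 1 - 2 * k) := by
          refine Finset.sum_le_sum fun k hk => ?_
          have := Finset.mem_range.1 hk
          omega
      _ ≤ ∑ k ∈ Finset.range n, (n - 1 - 2 * k) :=
          Finset.sum_le_sum_of_subset (Finset.range_mono (Nat.div_le_self _ _))
  have h3 : ((n / 4 : ℕ) : ℝ) * ((n - 1 - 2 * (n / 4) : ℕ) : ℝ) ≤
      ∑ u, ((freeReflections v u).card : ℝ) := by exact_mod_cast h2.trans h1
  refine le_trans ?_ h3
  have h4 : (n : ℝ) ≤ 4 * ((n / 4 : ℕ) : ℝ) + 3 := by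
    exact_mod_cast (by omega : n ≤ 4 * (n / 4) + 3)
  have h5 : (n : ℝ) ≤ 2 * ((n - 1 - 2 * (n / 4) : ℕ) : ℝ) + 2 := by
    exact_mod_cast (by omega : n ≤ 2 * (n - 1 - 2 * (n / 4)) + 2)
  have h6 : (16 : ℝ) ≤ n := by exact_mod_cast hn
  nlinarith [mul_le_mul (by linarith : ((n : ℝ) - 3) / 4 ≤ ((n / 4 : ℕ) : ℝ))
    (by linarith : ((n : ℝ) - 2) / 2 ≤ ((n - 1 - 2 * (n / 4) : ℕ) : ℝ)) (by linarith)
    (Nat.cast_nonneg _)]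

/-! ### Second moment method for stars -/

open MeasureTheory in
/-- The second moment method. -/
theorem measureReal_forall_notMem_le {Ω ι : Type*} [MeasurableSpace Ω] (μ : Measure Ω)
    [IsProbabilityMeasure μ] (F : Finset ι) (B : ι → Set Ω) (hB : ∀ i ∈ F, MeasurableSet (B i))
    {m δ : ℝ} (hm : 0 < m) (h1 : ∑ i ∈ F, μ.real (B i) = m)
    (h2 : ∑ i ∈ F, ∑ j ∈ F, μ.real (B i ∩ B j) ≤ m + (1 + δ) * m ^ 2) :
    μ.real {x | ∀ i ∈ F, x ∉ B i} ≤ 1 / m + δ := by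
  classical
  let X : Ω → ℝ := fun x => ∑ i ∈ F, (B i).indicator 1 x
  have hind : ∀ s : Set Ω, MeasurableSet s → Integrable (s.indicator (1 : Ω → ℝ)) μ :=
    fun s hs => (integrable_const (1 : ℝ)).indicator hs
  have hX : Integrable X μ := integrable_finsetSum _ fun i hi => hind _ (hB i hi)
  have hX1 : ∫ x, X x ∂μ = m := by
    rw [integral_finsetSum _ fun i hi => hind _ (hB i hi), ← h1]
    exact Finset.sum_congr rfl fun i hi => integral_indicator_one (hB i hi)
  have hXX : (fun x => X x ^ 2) =
      fun x => ∑ i ∈ F, ∑ j ∈ F, (B i ∩ B j).indicator (1 : Ω → ℝ) x := by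
    ext x
    simp only [X, sq, Finset.sum_mul_sum, Set.inter_indicator_one, Pi.mul_apply]
  have hmeas : ∀ i ∈ F, ∀ j ∈ F, MeasurableSet (B i ∩ B j) :=
    fun i hi j hj => (hB i hi).inter (hB j hj)
  have hX2 : Integrable (fun x => X x ^ 2) μ := by
    rw [hXX]
    exact integrable_finsetSum _ fun i hi => integrable_finsetSum _ fun j hj =>
      hind _ (hmeas i hi j hj)
  have hX2' : ∫ x, X x ^ 2 ∂μ ≤ m + (1 + δ) * m ^ 2 := by
    refine le_trans (le_of_eq ?_) h2
    rw [hXX, integral_finsetSum _ fun i hi => integrable_finsetSum _ fun j hj =>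
      hind _ (hmeas i hi j hj)]
    refine Finset.sum_congr rfl fun i hi => ?_
    rw [integral_finsetSum _ fun j hj => hind _ (hmeas i hi j hj)]
    exact Finset.sum_congr rfl fun j hj => integral_indicator_one (hmeas i hi j hj)
  have hY : Integrable (fun x => X x ^ 2 - 2 * m * X x + m ^ 2) μ :=
    (hX2.sub (hX.const_mul _)).add (integrable_const _)
  have hYint : ∫ x, (X x ^ 2 - 2 * m * X x + m ^ 2) ∂μ ≤ m + δ * m ^ 2 := by
    rw [integral_add (f := fun x => X x ^ 2 - 2 * m * X x) (hX2.sub (hX.const_mul _))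
      (integrable_const _), integral_sub hX2 (hX.const_mul _), integral_const_mul, hX1]
    simp only [integral_const, probReal_univ, one_smul]
    linarith
  -- Chebyshev's inequality: the integrand is `(X - m) ^ 2`, which equals `m ^ 2` where `X = 0`.
  have hmarkov := mul_meas_ge_le_integral_of_nonneg (μ := μ)
    (f := fun x => X x ^ 2 - 2 * m * X x + m ^ 2)
    (Eventually.of_forall fun x => by
      have : X x ^ 2 - 2 * m * X x + m ^ 2 = (X x - m) ^ 2 := by ring
      simp only [Pi.zero_apply, this]
      positivity) hY (m ^ 2)
  have hsub : {x | ∀ i ∈ F, x ∉ B i} ⊆ {x | m ^ 2 ≤ X x ^ 2 - 2 * m * X x + m ^ 2} := by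
    intro x hx
    have : X x = 0 := Finset.sum_eq_zero fun i hi => Set.indicator_of_notMem (hx i hi) _
    simp [this]
  have hle := measureReal_mono (μ := μ) hsub (measure_ne_top _ _)
  have : m ^ 2 * μ.real {x | ∀ i ∈ F, x ∉ B i} ≤ m + δ * m ^ 2 :=
    (mul_le_mul_of_nonneg_left hle (by positivity)).trans (hmarkov.trans hYint)
  have heq : 1 / m + δ = (m + δ * m ^ 2) / m ^ 2 := by field_simp
  rw [heq, le_div_iff₀ (by positivity)]
  linarith

theorem measurableSet_hasStar {V : Type*} [Countable V] (u : V) (o : Option V) :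
    MeasurableSet {G : SimpleGraph V | HasStar G u o} := by
  refine measurableSet_setOfPred.2 (.forall fun y => .imp measurable_const (.iff ?_ ?_))
  · exact SimpleGraph.measurable_iff_adj.1 measurable_id u y
  · exact measurable_const

theorem prod_ite_some_of_notMem {V : Type*} [DecidableEq V] {D : Finset V} {o : Option V}
    (ho : ∀ x ∈ D, o ≠ some x) (a b : ℝ) :
    ∏ y ∈ D, (if o = some y then a else b) = b ^ D.card := by
  rw [Finset.prod_congr rfl fun y hy => if_neg (ho y hy), Finset.prod_const]

section Star

variable {V : Type*} [Fintype V] [DecidableEq V] (p : I)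

theorem binomialRandom_real_hasStar (u : V) (o : Option V) :
    (SimpleGraph.binomialRandom V p).real {G | HasStar G u o} =
      ∏ y ∈ Finset.univ.erase u, if o = some y then (p : ℝ) else 1 - p := by
  have hset : {G : SimpleGraph V | HasStar G u o} =
      {G | ∀ y : ↥(Finset.univ.erase u), s(u, (y : V)) ∈ G.edgeSet ↔ o = some (y : V)} := by
    ext G
    simp [HasStar]
  rw [hset, binomialRandom_real_pattern p _ ?_ ?_]
  · exact Finset.prod_coe_sort (Finset.univ.erase u)
      fun y => if o = some y then (p : ℝ) else 1 - p
  · intro y z h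
    exact Subtype.ext (Sym2.congr_right.1 h)
  · intro y
    rw [Sym2.mk_isDiag_iff]
    exact (Finset.ne_of_mem_erase y.2).symm

/-- The two stars both constrain only the pair `uu'`. The second constraint on it is dropped,
leaving distinct pairs. -/
theorem binomialRandom_real_hasStar_inter_le {u u' : V} (huu : u ≠ u') (o o' : Option V) :
    (SimpleGraph.binomialRandom V p).real ({G | HasStar G u o} ∩ {G | HasStar G u' o'}) ≤
      (∏ y ∈ Finset.univ.erase u, if o = some y then (p : ℝ) else 1 - p) *
      ∏ y ∈ (Finset.univ.erase u').erase u, if o' = some y then (p : ℝ) else 1 - p := by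
  let f : ↥(Finset.univ.erase u) ⊕ ↥((Finset.univ.erase u').erase u) → Sym2 V :=
    Sum.elim (fun y => s(u, (y : V))) (fun y => s(u', (y : V)))
  let b : ↥(Finset.univ.erase u) ⊕ ↥((Finset.univ.erase u').erase u) → Prop :=
    Sum.elim (fun y => o = some (y : V)) (fun y => o' = some (y : V))
  have : DecidablePred b := Classical.decPred b
  have hsub : {G : SimpleGraph V | HasStar G u o} ∩ {G | HasStar G u' o'} ⊆
      {G | ∀ i, f i ∈ G.edgeSet ↔ b i} := by
    rintro G ⟨h, h'⟩ (y | y)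
    · exact h y (Finset.ne_of_mem_erase y.2)
    · exact h' y (Finset.ne_of_mem_erase (Finset.mem_of_mem_erase y.2))
  refine (MeasureTheory.measureReal_mono hsub (MeasureTheory.measure_ne_top _ _)).trans
    (le_of_eq ?_)
  rw [binomialRandom_real_pattern p f ?_ ?_, Fintype.prod_sum_type,
    ← Finset.prod_coe_sort (Finset.univ.erase u),
    ← Finset.prod_coe_sort ((Finset.univ.erase u').erase u)]
  · congr 1 <;> exact Finset.prod_congr rfl fun y _ => if_congr Iff.rfl rfl rfl
  · rintro (y | y) (z | z) h
    · exact congrArg _ (Subtype.ext (Sym2.congr_right.1 h))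
    · rcases Sym2.eq_iff.1 h with ⟨h1, -⟩ | ⟨h1, -⟩
      · exact absurd h1 huu
      · exact absurd h1.symm (Finset.ne_of_mem_erase z.2)
    · rcases Sym2.eq_iff.1 h with ⟨h1, -⟩ | ⟨-, h1⟩
      · exact absurd h1.symm huu
      · exact absurd h1 (Finset.ne_of_mem_erase y.2)
    · exact congrArg _ (Subtype.ext (Sym2.congr_right.1 h))
  · rintro (y | y)
    · simp only [f, Sum.elim_inl, Sym2.mk_isDiag_iff]
      exact (Finset.ne_of_mem_erase y.2).symm
    · simp only [f, Sum.elim_inr, Sym2.mk_isDiag_iff]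
      exact (Finset.ne_of_mem_erase (Finset.mem_of_mem_erase y.2)).symm

theorem sum_binomialRandom_real_hasStar {u : V} {T : Finset V} (hT : u ∉ T) :
    ∑ o ∈ Finset.insertNone T, (SimpleGraph.binomialRandom V p).real {G | HasStar G u o} =
      (1 - (p : ℝ)) ^ (Fintype.card V - 1) +
        T.card * (p * (1 - (p : ℝ)) ^ (Fintype.card V - 2)) := by
  have hcard : (Finset.univ.erase u).card = Fintype.card V - 1 := by
    rw [Finset.card_erase_of_mem (Finset.mem_univ _), Finset.card_univ]
  rw [Finset.sum_insertNone]
  congr 1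
  · rw [binomialRandom_real_hasStar, prod_ite_some_of_notMem (by simp), hcard]
  · rw [Finset.sum_congr rfl (g := fun _ => p * (1 - (p : ℝ)) ^ (Fintype.card V - 2)),
      Finset.sum_const, nsmul_eq_mul]
    intro x hx
    rw [binomialRandom_real_hasStar, prod_ite_some_of_mem, hcard, Nat.sub_sub]
    exact Finset.mem_erase.2 ⟨fun h => hT (h ▸ hx), Finset.mem_univ _⟩

/-- If `o' ≠ some u`, the dropped factor is `1 - p`. If `o' = some u`, the stars are compatible only
when `o = some u'`, making `uu'` an isolated edge. The indicators are kept as a product so that the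
double sum over `o`, `o'` factors. -/
theorem binomialRandom_real_hasStar_inter_le_mul {u u' : V} (huu : u ≠ u')
    (hp : (p : ℝ) < 1) (o o' : Option V) :
    (SimpleGraph.binomialRandom V p).real ({G | HasStar G u o} ∩ {G | HasStar G u' o'}) ≤
      (SimpleGraph.binomialRandom V p).real {G | HasStar G u o} *
        (SimpleGraph.binomialRandom V p).real {G | HasStar G u' o'} / (1 - p) +
      (if o = some u' then 1 else 0) * (if o' = some u then
        p * (1 - (p : ℝ)) ^ (2 * (Fintype.card V - 2)) else 0) := by
  have hq : 0 < 1 - (p : ℝ) := by linarith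
  have hp0 := p.2.1
  have hcard : ((Finset.univ.erase u').erase u).card = Fintype.card V - 2 := by
    rw [Finset.card_erase_of_mem (Finset.mem_erase.2 ⟨huu, Finset.mem_univ _⟩),
      Finset.card_erase_of_mem (Finset.mem_univ _), Finset.card_univ, Nat.sub_sub]
  by_cases h' : o' = some u
  · by_cases h : o = some u'
    · refine le_add_of_nonneg_of_le (by positivity) ?_
      refine (binomialRandom_real_hasStar_inter_le p huu o o').trans (le_of_eq ?_)
      rw [if_pos h, if_pos h', h, h', prod_ite_some_of_mem
        (Finset.mem_erase.2 ⟨huu.symm, Finset.mem_univ _⟩), prod_ite_some_of_notMem, hcard,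
        Finset.card_erase_of_mem (Finset.mem_univ _), Finset.card_univ, Nat.sub_sub]
      · ring
      · intro x hx h
        exact Finset.ne_of_mem_erase hx (Option.some_inj.1 h).symm
    · have hempty : {G : SimpleGraph V | HasStar G u o} ∩ {G | HasStar G u' o'} = ∅ := by
        ext G
        simp only [Set.mem_inter_iff, Set.mem_ofPred_eq, Set.mem_empty_iff_false, iff_false]
        rintro ⟨h1, h2⟩
        exact h ((h1 u' huu.symm).1 (((h2 u huu).2 h').symm))
      rw [hempty, MeasureTheory.measureReal_empty]
      positivity
  · refine le_add_of_le_of_nonneg ?_ (by positivity)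
    refine (binomialRandom_real_hasStar_inter_le p huu o o').trans (le_of_eq ?_)
    rw [binomialRandom_real_hasStar, binomialRandom_real_hasStar,
      ← Finset.mul_prod_erase (Finset.univ.erase u') _
        (Finset.mem_erase.2 ⟨huu, Finset.mem_univ _⟩), if_neg h']
    field_simp

end Star

theorem pow_two_mul_sub_two {q : ℝ} (hq0 : 0 < q) {n : ℕ} (hn : 2 ≤ n) :
    q ^ (2 * (n - 2)) = (q ^ (n - 1)) ^ 2 / q ^ 2 := by
  obtain ⟨k, rfl⟩ := Nat.exists_eq_add_of_le' hn
  have h1 : k + 2 - 2 = k := by omega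
  have h2 : k + 2 - 1 = k + 1 := by omega
  rw [h1, h2]
  field_simp
  ring

/-- If the expected number `m` of vertices without neighbours, or with a single neighbour in a
prescribed set, is large, then it is unlikely that there are no such vertices. -/
theorem binomialRandom_real_forall_not_hasStar_le {V : Type*} [Fintype V] [DecidableEq V]
    (p : I) (hp : (p : ℝ) < 1) (hV : 2 ≤ Fintype.card V) (T : V → Finset V)
    (hT : ∀ u, u ∉ T u) {m : ℝ} (hm : m = ∑ u, ((1 - (p : ℝ)) ^ (Fintype.card V - 1) +
      (T u).card * (p * (1 - (p : ℝ)) ^ (Fintype.card V - 2)))) (hm0 : 0 < m) :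
    (SimpleGraph.binomialRandom V p).real
      {G | ∀ u, ∀ o ∈ Finset.insertNone (T u), ¬ HasStar G u o} ≤
      1 / m + (1 / (1 - (p : ℝ)) + p / (1 - (p : ℝ)) ^ 2 - 1) := by
  have hq : 0 < 1 - (p : ℝ) := by linarith
  have hp0 := p.2.1
  set μ := SimpleGraph.binomialRandom V p
  let F : Finset (Σ _ : V, Option V) := Finset.univ.sigma fun u => Finset.insertNone (T u)
  let B : (Σ _ : V, Option V) → Set (SimpleGraph V) := fun i => {G | HasStar G i.1 i.2}
  let a : V → ℝ := fun u => (1 - (p : ℝ)) ^ (Fintype.card V - 1) +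
      (T u).card * (p * (1 - (p : ℝ)) ^ (Fintype.card V - 2))
  have ha : ∀ u, ∑ o ∈ Finset.insertNone (T u), μ.real {G | HasStar G u o} = a u :=
    fun u => sum_binomialRandom_real_hasStar p (hT u)
  have ha0 : ∀ u, (1 - (p : ℝ)) ^ (Fintype.card V - 1) ≤ a u := fun u =>
    le_add_of_nonneg_right (by positivity)
  have hset : {G : SimpleGraph V | ∀ u, ∀ o ∈ Finset.insertNone (T u), ¬ HasStar G u o} =
      {G | ∀ i ∈ F, G ∉ B i} := by
    ext G
    constructor
    · rintro h ⟨u, o⟩ hi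
      exact h u o (Finset.mem_sigma.1 hi).2
    · intro h u o ho
      exact h ⟨u, o⟩ (Finset.mem_sigma.2 ⟨Finset.mem_univ _, ho⟩)
  rw [hset]
  refine measureReal_forall_notMem_le μ F B (fun i _ => measurableSet_hasStar i.1 i.2) hm0 ?_ ?_
  · rw [hm, Finset.sum_sigma]
    exact Finset.sum_congr rfl fun u _ => ha u
  -- Different stars at one vertex are disjoint events, so only `o' = o` contributes.
  have hdiag : ∀ u, ∑ o ∈ Finset.insertNone (T u), ∑ o' ∈ Finset.insertNone (T u),
      μ.real ({G | HasStar G u o} ∩ {G | HasStar G u o'}) = a u := by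
    intro u
    rw [← ha u]
    refine Finset.sum_congr rfl fun o ho => ?_
    rw [Finset.sum_eq_single o]
    · rw [Set.inter_self]
    · intro o' ho' hne
      have hempty : {G : SimpleGraph V | HasStar G u o} ∩ {G | HasStar G u o'} = ∅ := by
        ext G
        simp only [Set.mem_inter_iff, Set.mem_ofPred_eq, Set.mem_empty_iff_false, iff_false]
        rintro ⟨h1, h2⟩
        have hmem : ∀ o'' ∈ Finset.insertNone (T u), ∀ x, o'' = some x → x ≠ u := by
          rintro _ h x rfl rfl
          exact hT x (by simpa using h)
        refine hne (Option.ext fun x => ?_)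
        constructor
        · intro hx
          exact (h1 x (hmem _ ho' x hx)).1 ((h2 x (hmem _ ho' x hx)).2 hx)
        · intro hx
          exact (h2 x (hmem _ ho x hx)).1 ((h1 x (hmem _ ho x hx)).2 hx)
      rw [hempty, MeasureTheory.measureReal_empty]
    · exact fun h => absurd ho h
  have hoff : ∀ u u', u ≠ u' → ∑ o ∈ Finset.insertNone (T u), ∑ o' ∈ Finset.insertNone (T u'),
      μ.real ({G | HasStar G u o} ∩ {G | HasStar G u' o'}) ≤
      (1 / (1 - (p : ℝ)) + p / (1 - (p : ℝ)) ^ 2) * (a u * a u') := by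
    intro u u' huu
    refine (Finset.sum_le_sum fun o _ => Finset.sum_le_sum fun o' _ =>
      binomialRandom_real_hasStar_inter_le_mul p huu hp o o').trans ?_
    simp only [Finset.sum_add_distrib, ← Finset.mul_sum, ← Finset.sum_mul, ← Finset.sum_div]
    rw [ha u, ha u', Finset.sum_ite_eq', Finset.sum_ite_eq']
    have hc : (p : ℝ) * (1 - (p : ℝ)) ^ (2 * (Fintype.card V - 2)) ≤
        p / (1 - (p : ℝ)) ^ 2 * (a u * a u') := by
      rw [pow_two_mul_sub_two hq hV]
      have : ((1 - (p : ℝ)) ^ (Fintype.card V - 1)) ^ 2 ≤ a u * a u' := by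
        rw [sq]
        exact mul_le_mul (ha0 u) (ha0 u') (by positivity) ((by positivity : (0 : ℝ) ≤ _).trans
          (ha0 u))
      calc (p : ℝ) * (((1 - (p : ℝ)) ^ (Fintype.card V - 1)) ^ 2 / (1 - (p : ℝ)) ^ 2) =
          p / (1 - (p : ℝ)) ^ 2 * ((1 - (p : ℝ)) ^ (Fintype.card V - 1)) ^ 2 := by ring
        _ ≤ _ := by gcongr
    have hite : (if some u' ∈ Finset.insertNone (T u) then (1 : ℝ) else 0) *
        (if some u ∈ Finset.insertNone (T u') then
          (p : ℝ) * (1 - (p : ℝ)) ^ (2 * (Fintype.card V - 2)) else 0) ≤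
        (p : ℝ) * (1 - (p : ℝ)) ^ (2 * (Fintype.card V - 2)) := by
      have : 0 ≤ (p : ℝ) * (1 - (p : ℝ)) ^ (2 * (Fintype.card V - 2)) := by positivity
      split_ifs <;> simp [this]
    refine (add_le_add le_rfl (hite.trans hc)).trans (le_of_eq ?_)
    ring
  have hexp : ∑ i ∈ F, ∑ j ∈ F, μ.real (B i ∩ B j) = ∑ u, ∑ u',
      ∑ o ∈ Finset.insertNone (T u), ∑ o' ∈ Finset.insertNone (T u'),
      μ.real ({G | HasStar G u o} ∩ {G | HasStar G u' o'}) := by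
    rw [Finset.sum_sigma]
    refine Finset.sum_congr rfl fun u _ => ?_
    exact (Finset.sum_congr rfl fun o _ => Finset.sum_sigma _ _ _).trans Finset.sum_comm
  rw [hexp]
  have hK : 0 ≤ 1 / (1 - (p : ℝ)) + p / (1 - (p : ℝ)) ^ 2 := by positivity
  have hapos : ∀ u, 0 ≤ a u := fun u => (by positivity : (0 : ℝ) ≤ _).trans (ha0 u)
  have hrow : ∀ u, ∑ u', ∑ o ∈ Finset.insertNone (T u), ∑ o' ∈ Finset.insertNone (T u'),
      μ.real ({G | HasStar G u o} ∩ {G | HasStar G u' o'}) ≤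
      a u + (1 / (1 - (p : ℝ)) + p / (1 - (p : ℝ)) ^ 2) * (a u * m) := by
    intro u
    rw [← Finset.add_sum_erase _ _ (Finset.mem_univ u), hdiag u]
    refine add_le_add le_rfl ?_
    refine (Finset.sum_le_sum fun u' hu' => hoff u u' (Finset.ne_of_mem_erase hu').symm).trans ?_
    rw [hm, ← Finset.mul_sum, ← Finset.mul_sum]
    refine mul_le_mul_of_nonneg_left (mul_le_mul_of_nonneg_left ?_ (hapos u)) hK
    exact Finset.sum_le_sum_of_subset_of_nonneg (Finset.erase_subset _ _) fun u' _ _ => hapos u'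
  refine (Finset.sum_le_sum fun u _ => hrow u).trans (le_of_eq ?_)
  rw [Finset.sum_add_distrib, ← Finset.mul_sum, ← Finset.sum_mul,
    show ∑ u, a u = m from hm.symm]
  ring

/-! ### Asymptotics below the threshold -/

/-- For `p ≤ 1/2`, `log (1 - p) ≥ -p - 2p²`; the `-1` in the exponent absorbs `2p²n ≤ 1`. -/
theorem exp_le_one_sub_pow {p : I} {n : ℕ} (hp : (p : ℝ) ≤ 1 / 2) (hpn : (p : ℝ) ^ 2 * n ≤ 1 / 2) :
    Real.exp (-(p * n) - 1) ≤ (1 - (p : ℝ)) ^ n := by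
  have hq : 0 < 1 - (p : ℝ) := by linarith
  have hp0 := p.2.1
  have hlog := Real.one_sub_inv_le_log_of_pos hq
  have h1 : -(p : ℝ) - 2 * (p : ℝ) ^ 2 ≤ Real.log (1 - p) := by
    refine le_trans ?_ hlog
    have : 1 - (1 - (p : ℝ))⁻¹ = -p / (1 - p) := by field_simp; ring
    rw [this, le_div_iff₀ hq]
    nlinarith [mul_nonneg (sq_nonneg (p : ℝ)) (by linarith : 0 ≤ 1 - 2 * (p : ℝ))]
  rw [← Real.exp_log hq, ← Real.exp_nat_mul, Real.exp_le_exp]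
  have h2 := mul_le_mul_of_nonneg_left h1 (Nat.cast_nonneg (α := ℝ) n)
  nlinarith

theorem tendsto_log_sq_div :
    Tendsto (fun n : ℕ => Real.log n ^ 2 / n) atTop (𝓝 0) :=
  (Real.isLittleO_pow_log_id_atTop (n := 2)).tendsto_div_nhds_zero.comp
    tendsto_natCast_atTop_atTop

theorem le_sum_hasStar_freeReflections {n : ℕ} (hn : 16 ≤ n) {v : Fin n → ℝ}
    (hv : Function.Injective v) {p : I} (hq : 0 < 1 - (p : ℝ)) :
    n / 16 * ((1 - (p : ℝ)) ^ n * (1 + p * n)) ≤ ∑ u, ((1 - (p : ℝ)) ^ (n - 1) +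
      (freeReflections v u).card * (p * (1 - (p : ℝ)) ^ (n - 2))) := by
  have hp0 := p.2.1
  have hn0 : (0 : ℝ) ≤ n := Nat.cast_nonneg n
  rw [Finset.sum_add_distrib, ← Finset.sum_mul]
  simp only [Finset.sum_const, Finset.card_univ, Fintype.card_fin, nsmul_eq_mul]
  have hcount := le_sum_card_freeReflections hn hv
  have h1 : (1 - (p : ℝ)) ^ n ≤ (1 - (p : ℝ)) ^ (n - 1) :=
    pow_le_pow_of_le_one hq.le (by linarith) (by omega)
  have h2 : (1 - (p : ℝ)) ^ n ≤ (1 - (p : ℝ)) ^ (n - 2) :=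
    pow_le_pow_of_le_one hq.le (by linarith) (by omega)
  have h3 : (n : ℝ) / 16 * (1 - (p : ℝ)) ^ n ≤ n * (1 - (p : ℝ)) ^ (n - 1) := by
    gcongr
    linarith
  have h4 : (n : ℝ) ^ 2 / 16 * (p * (1 - (p : ℝ)) ^ n) ≤
      (∑ u, ((freeReflections v u).card : ℝ)) * (p * (1 - (p : ℝ)) ^ (n - 2)) := by
    gcongr
  refine le_trans (le_of_eq ?_) (add_le_add h3 h4)
  ring

theorem exp_div_le_exp_neg_mul_one_add {n : ℕ} {y w : ℝ} (hl : 1 ≤ Real.log n)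
    (hl' : 0 ≤ Real.log (Real.log n)) (hn : (0 : ℝ) < n) (hy : 0 ≤ y) (hw : 1 ≤ w)
    (hyw : y ≤ Real.log n + Real.log (Real.log n) - w) :
    Real.exp w / (2 * w * n) ≤ Real.exp (-y) * (1 + y) := by
  have hanti := exp_neg_mul_one_add_antitone hy hyw
  have heq := exp_neg_log_add_log_log hl (-w)
  rw [← sub_eq_add_neg, neg_neg] at heq
  rw [heq] at hanti
  refine le_trans ?_ hanti
  rw [div_mul_eq_mul_div, div_le_div_iff₀ (by positivity) (by positivity)]
  -- If `w ≤ log n / 2`, the first factor is at least `log n / 2` and `2w ≥ 2`. Otherwise `2w ≥ log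
  -- n`, and the first factor is at least `1` because `0 ≤ y`.
  have h : Real.log n ≤ (1 + (Real.log n + Real.log (Real.log n) - w)) * (2 * w) := by
    rcases le_total w (Real.log n / 2) with h | h
    · nlinarith
    · nlinarith
  calc Real.exp w * (n * Real.log n) ≤ Real.exp w * (n *
        ((1 + (Real.log n + Real.log (Real.log n) - w)) * (2 * w))) := by gcongr
    _ = _ := by ring

theorem whp_not_reconstructible_univ (v : (n : ℕ) → Fin n → ℝ) (p : ℕ → I) (ω : ℕ → ℝ)
    (hv : ∀ n, Function.Injective (v n)) (hω : Tendsto ω atTop atTop)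
    (hp : ∀ᶠ n : ℕ in atTop,
      (p n : ℝ) ≤ (Real.log n + Real.log (Real.log n) - ω n) / (n : ℝ)) :
    Whp p fun n G => ¬ Reconstructible (v n) G Finset.univ := by
  have hp' : ∀ᶠ n : ℕ in atTop,
      (p n : ℝ) * n ≤ Real.log n + Real.log (Real.log n) - ω n := by
    filter_upwards [hp, eventually_gt_atTop 0] with n hpn hn
    rwa [le_div_iff₀ (by exact_mod_cast hn)] at hpn
  have hsmall : ∀ᶠ n : ℕ in atTop, (p n : ℝ) ≤ 2 * (Real.log n ^ 2 / n) ∧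
      (p n : ℝ) ^ 2 * n ≤ 4 * (Real.log n ^ 2 / n) := by
    filter_upwards [hp', eventually_log_log_le, hω.eventually_ge_atTop 0,
      eventually_gt_atTop 0] with n hpn hl hωn hn
    have hn0 : (0 : ℝ) < n := by exact_mod_cast hn
    have hp0 := (p n).2.1
    obtain ⟨hl1, hl2, hl3⟩ := hl
    have h2 : (p n : ℝ) * n ≤ 2 * Real.log n := by linarith
    constructor
    · rw [← mul_div_assoc, le_div_iff₀ hn0]
      nlinarith
    · rw [← mul_div_assoc, le_div_iff₀ hn0]
      have := pow_le_pow_left₀ (by positivity) h2 2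
      nlinarith
  have hpz : Tendsto (fun n => (p n : ℝ)) atTop (𝓝 0) := by
    refine tendsto_of_tendsto_of_tendsto_of_le_of_le' tendsto_const_nhds
      (by simpa using tendsto_log_sq_div.const_mul 2) (Eventually.of_forall fun n => (p n).2.1) ?_
    filter_upwards [hsmall] with n hn using hn.1
  have hq1 : Tendsto (fun n => 1 - (p n : ℝ)) atTop (𝓝 1) := by
    simpa using hpz.const_sub 1
  have hδ : Tendsto (fun n => 1 / (1 - (p n : ℝ)) + p n / (1 - (p n : ℝ)) ^ 2 - 1) atTop
      (𝓝 0) := by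
    have h1 : Tendsto (fun n => 1 / (1 - (p n : ℝ))) atTop (𝓝 (1 / 1)) :=
      tendsto_const_nhds.div hq1 one_ne_zero
    have h2 : Tendsto (fun n => (p n : ℝ) / (1 - (p n : ℝ)) ^ 2) atTop (𝓝 (0 / 1 ^ 2)) :=
      hpz.div (hq1.pow 2) (by norm_num)
    simpa using (h1.add h2).sub_const 1
  have hω' : Tendsto (fun n => 32 * Real.exp 1 * (ω n * Real.exp (-ω n))) atTop (𝓝 0) := by
    have h2 : Tendsto (fun n => ω n * Real.exp (-ω n)) atTop (𝓝 0) := by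
      simpa [Function.comp_def] using (Real.tendsto_pow_mul_exp_neg_atTop_nhds_zero 1).comp hω
    simpa using h2.const_mul (32 * Real.exp 1)
  have hlim := hω'.add hδ
  rw [add_zero] at hlim
  refine Whp.of_real_le hlim ?_
  filter_upwards [hp', hsmall, eventually_log_log_le, hω.eventually_ge_atTop 1,
    eventually_ge_atTop 16, hpz.eventually_le_const (by norm_num : (0 : ℝ) < 1 / 2),
    tendsto_log_sq_div.eventually_le_const (by norm_num : (0 : ℝ) < 1 / 8)]
    with n hpn hsm hl hωn hn hhalf hlogsq
  obtain ⟨hl1, hl2, hl3⟩ := hl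
  have hn0 : (0 : ℝ) < n := by exact_mod_cast (by omega : 0 < n)
  have hp0 := (p n).2.1
  have hq : 0 < 1 - (p n : ℝ) := by linarith
  have hm1 := le_sum_hasStar_freeReflections hn (hv n) hq
  -- The expected number of free stars tends to infinity with `ω`: `32` is `16 * 2`, from the pair
  -- count and the factor `2w`, and `exp 1` is the loss in `exp_le_one_sub_pow`.
  have hm2 : Real.exp (ω n) / (32 * Real.exp 1 * ω n) ≤
      n / 16 * ((1 - (p n : ℝ)) ^ n * (1 + p n * n)) := by
    have h1 := exp_le_one_sub_pow hhalf (by linarith : (p n : ℝ) ^ 2 * n ≤ 1 / 2)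
    have h2 := exp_div_le_exp_neg_mul_one_add hl1 hl2 hn0 (by positivity) hωn hpn
    calc Real.exp (ω n) / (32 * Real.exp 1 * ω n)
        = n / 16 * (Real.exp (ω n) / (2 * ω n * n) / Real.exp 1) := by field_simp; norm_num
      _ ≤ n / 16 * (Real.exp (-(p n * n)) * (1 + p n * n) / Real.exp 1) := by gcongr
      _ = n / 16 * (Real.exp (-(p n * n) - 1) * (1 + p n * n)) := by rw [Real.exp_sub]; ring
      _ ≤ _ := by gcongr
  have hpos : 0 < Real.exp (ω n) / (32 * Real.exp 1 * ω n) := by positivity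
  have hmain := binomialRandom_real_forall_not_hasStar_le (p n) (by linarith)
    (by rw [Fintype.card_fin]; omega) (freeReflections (v n))
    (fun u => by simp [freeReflections]) rfl
    (by rw [Fintype.card_fin]; exact hpos.trans_le (hm2.trans hm1))
  rw [Fintype.card_fin] at hmain
  have hinv := one_div_le_one_div_of_le hpos (hm2.trans hm1)
  have heq : 1 / (Real.exp (ω n) / (32 * Real.exp 1 * ω n)) =
      32 * Real.exp 1 * (ω n * Real.exp (-ω n)) := by
    rw [Real.exp_neg]
    field_simp
  rw [heq] at hinv
  refine le_trans (MeasureTheory.measureReal_mono ?_ (MeasureTheory.measure_ne_top _ _))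
    (hmain.trans (add_le_add hinv le_rfl))
  intro G hG u o ho hstar
  exact hG (not_reconstructible_univ_of_hasStar (by omega) (hv n) ho hstar)

theorem theorem1p2 :
    (∃ c : ℝ, 0 < c ∧
      ∀ (v : (n : ℕ) → Fin n → ℝ) (p : ℕ → I), (∀ n, Function.Injective (v n)) →
        (∀ᶠ n : ℕ in atTop, 42 / (n : ℝ) ≤ (p n : ℝ)) →
        Whp p fun n G => ∃ U : Finset (Fin n), Reconstructible (v n) G U ∧
          c * (n : ℝ) ≤ (U.card : ℝ)) ∧
    (∀ p : ℕ → I, Tendsto (fun n : ℕ => (p n : ℝ) * (n : ℝ)) atTop atTop →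
      ∃ ε : ℕ → ℝ, Tendsto ε atTop (𝓝 0) ∧
        ∀ v : (n : ℕ) → Fin n → ℝ, (∀ n, Function.Injective (v n)) →
          Whp p fun n G => ∃ U : Finset (Fin n), Reconstructible (v n) G U ∧
            (1 - ε n) * (n : ℝ) ≤ (U.card : ℝ)) ∧
    (∀ (v : (n : ℕ) → Fin n → ℝ) (p : ℕ → I) (ω : ℕ → ℝ), (∀ n, Function.Injective (v n)) →
      Tendsto ω atTop atTop →
      (∀ᶠ n : ℕ in atTop,
        (p n : ℝ) ≤ (Real.log n + Real.log (Real.log n) - ω n) / (n : ℝ)) →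
      Whp p fun n G => ¬ Reconstructible (v n) G Finset.univ) ∧
    (∀ (v : (n : ℕ) → Fin n → ℝ) (p : ℕ → I) (ω : ℕ → ℝ), (∀ n, Function.Injective (v n)) →
      Tendsto ω atTop atTop →
      (∀ᶠ n : ℕ in atTop,
        (Real.log n + Real.log (Real.log n) + ω n) / (n : ℝ) ≤ (p n : ℝ)) →
      Whp p fun n G => Reconstructible (v n) G Finset.univ) := by
  exact ⟨exists_linear_reconstructible, exists_almost_spanning_reconstructible,
    whp_not_reconstructible_univ, whp_reconstructible_univ⟩
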